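/- There is a universal constant $C>0$ such that the following holds. Let $N\ge 1$, $r_1\ge1$, $r_{2,(i)}\ge 1$ and $n_i\ge 1$ for $i=1,\dots,N$. For each client $i$ let $y_{(i),1},\dots,y_{(i),n_i}\in\mathbb R^d$ be i.i.d. random vectors with covariance matrix $\Sigma_{(i)}$ that are sub-Gaussian with parameter $\sigma\ge 0$, i.e. $\mathbb E\,e^{\lambda\langle v,y\rangle}\le e^{\lambda^2\sigma^2/2}$ for every unit vector $v$ and every $\lambda\in\mathbb R$. Let $Y_{(i)}=[y_{(i),1},\dots,y_{(i),n_i}]$ and $S_{(i)}=\frac1{n_i}Y_{(i)}Y_{(i)}^T$. For a matrix $U$ with orthonormal columns let $P_U=UU^T$. Let $U_{\rm true}\in\mathbb R^{d\times r_1}$ and $V_{(i),\rm true}\in\mathbb R^{d\times r_{2,(i)}}$ have orthonormal columns, and let $\Pi_g=P_{U_{\rm true}}$, $\Pi_{(i)}=P_{V_{(i),\rm true}}$. For a symmetric $d\times d$ matrix let $\lambda_1\ge\lambda_2\ge\dots\ge\lambda_d$ denote its eigenvalues with multiplicity and $\lambda_{\max}=\lambda_1$. Assume: (1) $\Sigma_{(i)}=\Sigma_{(i),g}\oplus\Sigma_{(i),l}$,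 i.e. $\Sigma_{(i)}=\Sigma_{(i),g}+\Sigma_{(i),l}$ with $\Sigma_{(i),g},\Sigma_{(i),l}$ symmetric and $\Sigma_{(i),g}\Sigma_{(i),l}=0$; moreover $\mathrm{col}(\Pi_g)\subseteq\mathrm{col}(\Sigma_{(i),g})$, $\mathrm{col}(\Pi_{(i)})\subseteq\mathrm{col}(\Sigma_{(i),l})$, and for every $i$ the matrices $\Pi_g$ and $\Pi_{(i)}$ are the orthogonal projections onto spans of orthonormal eigenvectors belonging to the $r_1$ largest eigenvalues of $\Sigma_{(i),g}$ and to the $r_{2,(i)}$ largest eigenvalues of $\Sigma_{(i),l}$, respectively; (2) $\lambda_{\max}\big(\frac1N\sum_{i=1}^N\Pi_{(i)}\big)\le 1-\theta$ for some $\theta\in(0,1)$; (3) there is $\delta>0$ with $\min\{\lambda_{r_1}(\Sigma_{(i),g}),\lambda_{r_{2,(i)}}(\Sigma_{(i),l})\}-\max\{\lambda_{r_1+1}(\Sigma_{(i),g}),\lambda_{r_{2,(i)}+1}(\Sigma_{(i),l})\}\ge\delta$ for all $i$. Let $\widetilde\delta\in(0,1)$. Then, with probability at least $1-\widetilde\delta$,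 every maximizer $(\hat U,\{\hat V_{(i)}\})$ of $$\frac12\sum_{i=1}^N\Big[\mathrm{tr}(U^TS_{(i)}U)+\mathrm{tr}(V_{(i)}^TS_{(i)}V_{(i)})\Big]$$ over $U\in\mathbb R^{d\times r_1}$, $V_{(i)}\in\mathbb R^{d\times r_{2,(i)}}$ subject to $U^TU=I$, $V_{(i)}^TV_{(i)}=I$, $V_{(i)}^TU=0$ for all $i$, satisfies $$\|P_{\hat U}-\Pi_g\|_F^2+\frac1N\sum_{i=1}^N\|P_{\hat V_{(i)}}-\Pi_{(i)}\|_F^2\le\frac{4}{\theta\delta^2}\,\sigma^4C^2\,\frac dN\sum_{i=1}^N\max\left\{\left(\frac{d+\log\frac{2N}{\widetilde\delta}}{n_i}\right)^2,\frac{d+\log\frac{2N}{\widetilde\delta}}{n_i}\right\}.$$ On the same event, if $n_i\ge d+\log\frac{2N}{\widetilde\delta}$ for all $i$, the left-hand side is at most $\frac{4}{\theta\delta^2}\sigma^4C^2\,d\,\big(d+\log\frac{2N}{\widetilde\delta}\big)\cdot\frac1N\sum_{i=1}^N\frac1{n_i}$; and for every integer $n$ with $n\ge d+\log\frac{2N}{\widetilde\delta}$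 and $n_i\ge n$ for all $i$, it is at most $\frac{4}{\theta\delta^2}\sigma^4C^2\,d\,\big(d+\log\frac{2N}{\widetilde\delta}\big)\cdot\frac1n$, an $O(1/n)$ consistency rate. -/

import Mathlib

open MeasureTheory ProbabilityTheory Matrix
open scoped NNReal Matrix.Norms.Frobenius

namespace PerPCA

noncomputable section

/-- The `k`-th largest eigenvalue (counted with multiplicity, `k = 1, ..., d`) of a real
symmetric `d × d` matrix; the value is `0` outside this range. -/
def sortedEigenvalue {d : ℕ} (A : Matrix (Fin d) (Fin d) ℝ) (k : ℕ) : ℝ :=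
  open Classical in
  if h : A.IsHermitian ∧ 1 ≤ k ∧ k ≤ d then
    h.1.eigenvalues₀ ⟨k - 1, by rw [Fintype.card_fin]; omega⟩
  else 0

/-- The largest eigenvalue of a real symmetric matrix. -/
def maxEigenvalue {d : ℕ} (A : Matrix (Fin d) (Fin d) ℝ) : ℝ := sortedEigenvalue A 1

/-- The projection matrix `P_U = U Uᵀ` of a matrix with orthonormal columns. -/
def proj {d r : ℕ} (U : Matrix (Fin d) (Fin r) ℝ) : Matrix (Fin d) (Fin d) ℝ := U * Uᵀ

/-- `P` is the orthogonal projection onto the span of `r` orthonormal eigenvectors of `A`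
belonging to the `r` largest eigenvalues `λ₁(A), ..., λ_r(A)`. -/
def IsTopEigenspaceProjection {d : ℕ} (A : Matrix (Fin d) (Fin d) ℝ) (r : ℕ)
    (P : Matrix (Fin d) (Fin d) ℝ) : Prop :=
  ∃ W : Matrix (Fin d) (Fin r) ℝ, Wᵀ * W = 1 ∧
    A * W = W * Matrix.diagonal (fun k : Fin r => sortedEigenvalue A (k.val + 1)) ∧
    P = proj W

/-- `A = B ⊕ C`: the sum of two symmetric matrices with mutually orthogonal column spaces. -/
structure IsOrthogonalDirectSum {d : ℕ} (A B C : Matrix (Fin d) (Fin d) ℝ) : Prop where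
  symm_left : B.IsSymm
  symm_right : C.IsSymm
  eq_add : A = B + C
  mul_eq_zero : B * C = 0

/-- The column space of `A` is contained in that of `B`. -/
def ColSubset {d : ℕ} (A B : Matrix (Fin d) (Fin d) ℝ) : Prop :=
  LinearMap.range A.mulVecLin ≤ LinearMap.range B.mulVecLin

/-- The covariance matrix of a law on `ℝᵈ`. -/
def populationCovariance {d : ℕ} (ν : Measure (Fin d → ℝ)) : Matrix (Fin d) (Fin d) ℝ :=
  Matrix.of fun k l => cov[fun x : Fin d → ℝ => x k, fun x : Fin d → ℝ => x l; ν]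

/-- `ν` is sub-Gaussian with parameter `σ`: for every unit vector `v` and every real `t`,
`∫ exp (t ⟨v, x⟩) dν(x)` is finite and at most `exp (σ² t² / 2)`. -/
def IsSubGaussian {d : ℕ} (ν : Measure (Fin d → ℝ)) (σ : ℝ≥0) : Prop :=
  ∀ v : Fin d → ℝ, v ⬝ᵥ v = 1 → HasSubgaussianMGF (fun x : Fin d → ℝ => v ⬝ᵥ x) (σ ^ 2) ν

/-- `y 0, ..., y (n - 1)` are independent random vectors in `ℝᵈ`, each with law `ν`. -/
structure IsIIDSample {Ω : Type*} [MeasurableSpace Ω] (μ : Measure Ω) {d n : ℕ}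
    (y : Fin n → Ω → (Fin d → ℝ)) (ν : Measure (Fin d → ℝ)) : Prop where
  measurable : ∀ j, Measurable (y j)
  map_eq : ∀ j, μ.map (y j) = ν
  indep : iIndepFun y μ

/-- The `d × n` data matrix whose columns are the observations. -/
def dataMatrix {d n : ℕ} (y : Fin n → (Fin d → ℝ)) : Matrix (Fin d) (Fin n) ℝ :=
  Matrix.of fun k j => y j k

/-- The data covariance matrix `S = (1/n) Y Yᵀ`. -/
def sampleCovariance {d n : ℕ} (Y : Matrix (Fin d) (Fin n) ℝ) : Matrix (Fin d) (Fin d) ℝ :=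
  (1 / (n : ℝ)) • (Y * Yᵀ)

/-- The constraints `Uᵀ U = I`, `Vᵢᵀ Vᵢ = I`, `Vᵢᵀ U = 0`. -/
structure IsFeasible {d r₁ N : ℕ} {r₂ : Fin N → ℕ} (U : Matrix (Fin d) (Fin r₁) ℝ)
    (V : ∀ i, Matrix (Fin d) (Fin (r₂ i)) ℝ) : Prop where
  orthonormal_global : Uᵀ * U = 1
  orthonormal_local : ∀ i, (V i)ᵀ * V i = 1
  orthogonal : ∀ i, (V i)ᵀ * U = 0

/-- The objective `½ ∑ᵢ [tr (Uᵀ Sᵢ U) + tr (Vᵢᵀ Sᵢ Vᵢ)]`. -/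
def objective {d r₁ N : ℕ} {r₂ : Fin N → ℕ} (S : Fin N → Matrix (Fin d) (Fin d) ℝ)
    (U : Matrix (Fin d) (Fin r₁) ℝ) (V : ∀ i, Matrix (Fin d) (Fin (r₂ i)) ℝ) : ℝ :=
  (1 / 2) * ∑ i, ((Uᵀ * S i * U).trace + ((V i)ᵀ * S i * V i).trace)

/-- `(U, V)` maximizes the objective under the constraints. -/
def IsOptimal {d r₁ N : ℕ} {r₂ : Fin N → ℕ} (S : Fin N → Matrix (Fin d) (Fin d) ℝ)
    (U : Matrix (Fin d) (Fin r₁) ℝ) (V : ∀ i, Matrix (Fin d) (Fin (r₂ i)) ℝ) : Prop :=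
  IsFeasible U V ∧
    ∀ (U' : Matrix (Fin d) (Fin r₁) ℝ) (V' : ∀ i, Matrix (Fin d) (Fin (r₂ i)) ℝ),
      IsFeasible U' V' → objective S U' V' ≤ objective S U V

/-- The subspace error `‖P_U - Π_g‖_F² + (1/N) ∑ᵢ ‖P_{Vᵢ} - Πᵢ‖_F²`
(the norms are Frobenius norms). -/
def subspaceError {d r₁ N : ℕ} {r₂ : Fin N → ℕ}
    (U U₀ : Matrix (Fin d) (Fin r₁) ℝ) (V V₀ : ∀ i, Matrix (Fin d) (Fin (r₂ i)) ℝ) : ℝ :=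
  ‖proj U - proj U₀‖ ^ 2 + (1 / (N : ℝ)) * ∑ i, ‖proj (V i) - proj (V₀ i)‖ ^ 2

end

end PerPCA

namespace PerPCA

/-! The argument joins a deterministic perturbation bound to a concentration inequality.

Deterministic part. For a feasible pair, `R i = proj U + proj (V i)` is an orthogonal projection,
and the objective is half the sum of tr(Sᵢ Rᵢ), so it is linear in the `R i`. Let R⁰ᵢ be the true
counterpart. It projects onto eigenvectors of Σᵢ whose eigenvalues exceed all others by δ, hence
tr(Σᵢ(R⁰ᵢ - R)) ≥ (δ/2)‖R - R⁰ᵢ‖² for every projection R of the same trace (`client_curvature`). The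
truth is feasible, so optimality gives ∑ tr(Sᵢ(R⁰ᵢ - Rᵢ)) ≤ 0. Young's inequality applied to tr((Sᵢ
- Σᵢ)(Rᵢ - R⁰ᵢ)) then yields ∑‖Rᵢ - R⁰ᵢ‖² ≤ (4/δ²) ∑‖Sᵢ - Σᵢ‖².

A single Rᵢ does not determine its global and local summands, since directions could be exchanged
between them. The bound 1 - θ on the averaged local projections prevents the same exchange on all
clients, and `identifiability` recovers both errors at the price 5/θ.

Probabilistic part. `sq_norm_le_of_net` reduces ‖Sᵢ - Σᵢ‖ to quadratic forms at the at most 5^d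
points of a net; the factor d is the passage from operator to Frobenius norm. In a fixed direction
the deviation is a centred average of squares of sub-Gaussian variables, controlled by Bernstein's
inequality (`measureReal_average_sq_sub_le`). A union bound over net and clients is paid for by L =
d + log(2N/η). -/

/-! ### Ordered eigenvalues and quadratic forms -/

lemma sortedEigenvalue_succ {d : ℕ} {A : Matrix (Fin d) (Fin d) ℝ} (hA : A.IsHermitian)
    (j : Fin d) :
    sortedEigenvalue A (j.val + 1) = hA.eigenvalues₀ (Fin.cast (Fintype.card_fin d).symm j) := by
  have h : A.IsHermitian ∧ 1 ≤ j.val + 1 ∧ j.val + 1 ≤ d := ⟨hA, by omega, by omega⟩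
  unfold sortedEigenvalue
  rw [dif_pos h]
  rfl

lemma sortedEigenvalue_le {d : ℕ} {A : Matrix (Fin d) (Fin d) ℝ} (hA : A.IsHermitian)
    {k l : ℕ} (hk : 1 ≤ k) (hkl : k ≤ l) (hl : l ≤ d) :
    sortedEigenvalue A l ≤ sortedEigenvalue A k := by
  obtain ⟨k, rfl⟩ := Nat.exists_eq_add_of_le' hk
  obtain ⟨l, rfl⟩ := Nat.exists_eq_add_of_le' (hk.trans hkl)
  rw [sortedEigenvalue_succ hA ⟨k, by omega⟩, sortedEigenvalue_succ hA ⟨l, by omega⟩]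
  apply hA.eigenvalues₀_antitone
  simp only [Fin.le_def, Fin.val_cast]
  omega

/-- Spectral theorem with the eigenvalues in decreasing order. -/
lemma exists_sorted_diagonalization {d : ℕ} {A : Matrix (Fin d) (Fin d) ℝ}
    (hA : A.IsHermitian) :
    ∃ Q : Matrix (Fin d) (Fin d) ℝ, Qᵀ * Q = 1 ∧ Q * Qᵀ = 1 ∧
      A * Q = Q * diagonal (fun j : Fin d => sortedEigenvalue A (j.val + 1)) := by
  let g : Fin d ≃ Fin d :=
    (finCongr (Fintype.card_fin d).symm).trans (Fintype.equivOfCardEq (Fintype.card_fin _))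
  let Q₀ : Matrix (Fin d) (Fin d) ℝ := hA.eigenvectorUnitary
  have h1 : Q₀ᵀ * Q₀ = 1 := by
    have := Unitary.coe_star_mul_self hA.eigenvectorUnitary
    rwa [star_eq_conjTranspose, conjTranspose_eq_transpose_of_trivial] at this
  have hQ : (Q₀.submatrix id g)ᵀ * Q₀.submatrix id g = 1 := by
    rw [transpose_submatrix, ← submatrix_mul _ _ g id g Function.bijective_id, h1,
      submatrix_one_equiv]
  refine ⟨Q₀.submatrix id g, hQ, mul_eq_one_comm.mp hQ, ?_⟩
  ext i j
  have := congrFun (hA.mulVec_eigenvectorBasis (g j)) i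
  rw [mul_diagonal, sortedEigenvalue_succ hA j, Matrix.mul_apply]
  simp only [mulVec, dotProduct, Pi.smul_apply, smul_eq_mul] at this
  simp only [submatrix_apply, id_eq, Q₀, IsHermitian.eigenvectorUnitary_apply]
  rw [this, mul_comm]
  congr 1
  simp [IsHermitian.eigenvalues, g]

/-- The quadratic form in an eigenbasis. -/
lemma quadratic_eq_sum {d : ℕ} {A Q : Matrix (Fin d) (Fin d) ℝ} {l : Fin d → ℝ}
    (hQ : Q * Qᵀ = 1) (hA : A * Q = Q * diagonal l) (x : Fin d → ℝ) :
    x ⬝ᵥ A *ᵥ x = ∑ j, l j * (Qᵀ *ᵥ x) j ^ 2 := by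
  have : A = Q * diagonal l * Qᵀ := by rw [← hA, Matrix.mul_assoc, hQ, Matrix.mul_one]
  rw [this, ← mulVec_mulVec, ← mulVec_mulVec, dotProduct_mulVec, ← mulVec_transpose]
  simp only [dotProduct, mulVec_diagonal]
  exact Finset.sum_congr rfl fun j _ => by ring

lemma dotProduct_self_eq_sum {d : ℕ} {Q : Matrix (Fin d) (Fin d) ℝ}
    (hQ : Q * Qᵀ = 1) (x : Fin d → ℝ) :
    x ⬝ᵥ x = ∑ j, (Qᵀ *ᵥ x) j ^ 2 := by
  have := quadratic_eq_sum (A := 1) (l := fun _ => 1) hQ (by simp) x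
  simpa using this

lemma posSemidef_of_quadratic {d : ℕ} {A : Matrix (Fin d) (Fin d) ℝ} (hA : A.IsHermitian)
    (h : ∀ x : Fin d → ℝ, 0 ≤ x ⬝ᵥ A *ᵥ x) : A.PosSemidef :=
  PosSemidef.of_dotProduct_mulVec_nonneg hA fun x => by simpa using h x

lemma maxEigenvalue_smul_one_sub_posSemidef {d : ℕ} {A : Matrix (Fin d) (Fin d) ℝ}
    (hA : A.IsHermitian) : (maxEigenvalue A • (1 : Matrix (Fin d) (Fin d) ℝ) - A).PosSemidef := by
  obtain ⟨Q, -, hQ, hAQ⟩ := exists_sorted_diagonalization hA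
  refine posSemidef_of_quadratic ((isHermitian_one.smul (by simp [IsSelfAdjoint])).sub hA)
    fun x => ?_
  rw [sub_mulVec, dotProduct_sub, quadratic_eq_sum hQ hAQ, smul_mulVec, one_mulVec,
    dotProduct_smul, dotProduct_self_eq_sum hQ, smul_eq_mul, Finset.mul_sum, sub_nonneg]
  refine Finset.sum_le_sum fun j _ => mul_le_mul_of_nonneg_right ?_ (sq_nonneg _)
  exact sortedEigenvalue_le hA le_rfl (by omega) (by omega)

/-! ### Orthogonal projections and traces -/

lemma isStarProjection_proj {d r : ℕ} {W : Matrix (Fin d) (Fin r) ℝ} (hW : Wᵀ * W = 1) :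
    IsStarProjection (proj W) where
  isIdempotentElem := by
    rw [IsIdempotentElem, proj, Matrix.mul_assoc, ← Matrix.mul_assoc Wᵀ, hW, Matrix.one_mul]
  isSelfAdjoint := by
    rw [IsSelfAdjoint, star_eq_conjTranspose, conjTranspose_eq_transpose_of_trivial, proj,
      transpose_mul, transpose_transpose]

lemma trace_proj {d r : ℕ} {W : Matrix (Fin d) (Fin r) ℝ} (hW : Wᵀ * W = 1) :
    (proj W).trace = r := by
  rw [proj, trace_mul_comm, hW, trace_one, Fintype.card_fin]

lemma _root_.IsStarProjection.transpose_eq {n : Type*} [Fintype n] {P : Matrix n n ℝ}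
    (hP : IsStarProjection P) : Pᵀ = P := by
  rw [← conjTranspose_eq_transpose_of_trivial]; exact hP.isSelfAdjoint

lemma _root_.IsStarProjection.matrix_posSemidef {n : Type*} [Fintype n] {P : Matrix n n ℝ}
    (hP : IsStarProjection P) : P.PosSemidef := by
  have := posSemidef_self_mul_conjTranspose P
  rwa [conjTranspose_eq_transpose_of_trivial, hP.transpose_eq, hP.isIdempotentElem.eq] at this

lemma le_of_transpose_mul_self_eq_one {d r : ℕ} {W : Matrix (Fin d) (Fin r) ℝ}
    (hW : Wᵀ * W = 1) : r ≤ d := by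
  have h1 := (isStarProjection_proj hW).one_sub.matrix_posSemidef.trace_nonneg
  rw [trace_sub, trace_proj hW, trace_one, Fintype.card_fin, sub_nonneg] at h1
  exact_mod_cast h1

/-- The trace pairing of a positive semidefinite matrix with a projection is nonnegative. -/
lemma trace_mul_nonneg {n : Type*} [Fintype n] {M P : Matrix n n ℝ}
    (hM : M.PosSemidef) (hP : IsStarProjection P) : 0 ≤ (M * P).trace := by
  have := (hM.mul_mul_conjTranspose_same P).trace_nonneg
  rwa [conjTranspose_eq_transpose_of_trivial, hP.transpose_eq, trace_mul_comm,
    ← Matrix.mul_assoc, hP.isIdempotentElem.eq, trace_mul_comm] at this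

lemma sum_castLE {d r : ℕ} (hrd : r ≤ d) (f : Fin d → ℝ) (hf : ∀ j : Fin d, r ≤ j.val → f j = 0) :
    ∑ j, f (Fin.castLE hrd j) = ∑ j, f j := by
  refine (Finset.sum_map Finset.univ (Fin.castLEEmb hrd) f).symm.trans
    (Finset.sum_subset (Finset.subset_univ _) fun j _ hj => hf j ?_)
  by_contra hlt
  exact hj (Finset.mem_map.mpr ⟨⟨j.val, by omega⟩, Finset.mem_univ _, rfl⟩)

/-! ### Spectral bounds on and off a top eigenspace -/

section TopEigenspace

variable {d r : ℕ} {A P : Matrix (Fin d) (Fin d) ℝ}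

/-- On the orthogonal complement of the top eigenspace the quadratic form is bounded by the next
eigenvalue. -/
lemma IsTopEigenspaceProjection.quadratic_le (h : IsTopEigenspaceProjection A r P)
    (hA : A.IsHermitian) (hgap : sortedEigenvalue A (r + 1) < sortedEigenvalue A r)
    {x : Fin d → ℝ} (hx : P *ᵥ x = 0) :
    x ⬝ᵥ A *ᵥ x ≤ sortedEigenvalue A (r + 1) * (x ⬝ᵥ x) := by
  obtain ⟨W, hW, hAW, rfl⟩ := h
  obtain ⟨Q, hQ', hQ, hAQ⟩ := exists_sorted_diagonalization hA
  have hrd : r ≤ d := le_of_transpose_mul_self_eq_one hW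
  have hAt : Aᵀ = A := by rw [← conjTranspose_eq_transpose_of_trivial]; exact hA
  -- the matrix of inner products between the two systems of eigenvectors
  set O := Qᵀ * W with hO
  have hcomm : diagonal (fun j : Fin d => sortedEigenvalue A (j.val + 1)) * O
      = O * diagonal (fun k : Fin r => sortedEigenvalue A (k.val + 1)) := by
    have h2 : diagonal (fun j : Fin d => sortedEigenvalue A (j.val + 1)) * Qᵀ = Qᵀ * A := by
      have := congrArg transpose hAQ
      rw [transpose_mul, transpose_mul, hAt, diagonal_transpose] at this
      exact this.symm
    rw [hO, ← Matrix.mul_assoc, h2, Matrix.mul_assoc, hAW, Matrix.mul_assoc]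
  -- `W` and `Q` may be different eigenbases when eigenvalues repeat. The strict gap after position
  -- r still makes every column of `W` orthogonal to the lower eigenvectors in `Q`.
  have hO0 : ∀ (j : Fin d) (k : Fin r), r ≤ j.val → O j k = 0 := by
    intro j k hj
    have h3 := congrFun (congrFun hcomm j) k
    rw [diagonal_mul, mul_diagonal] at h3
    have h4 : sortedEigenvalue A (j.val + 1) < sortedEigenvalue A (k.val + 1) :=
      (sortedEigenvalue_le hA (by omega) (by omega) (by omega)).trans_lt
        (hgap.trans_le (sortedEigenvalue_le hA (by omega) (by omega) (by omega)))
    have h5 : (sortedEigenvalue A (k.val + 1) - sortedEigenvalue A (j.val + 1)) * O j k = 0 := by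
      linarith
    exact (mul_eq_zero.mp h5).resolve_left (by linarith)
  have hOO : Oᵀ * O = 1 := by
    rw [hO, transpose_mul, transpose_transpose, Matrix.mul_assoc, ← Matrix.mul_assoc Q, hQ,
      Matrix.one_mul, hW]
  -- The upper block is square with orthonormal columns, hence invertible, so a vector orthogonal to
  -- `W` has no component along the first r columns of `Q`.
  let O₁ : Matrix (Fin r) (Fin r) ℝ := O.submatrix (Fin.castLE hrd) id
  have hO₁ : O₁ᵀ * O₁ = 1 := by
    rw [← hOO]
    ext a b
    simp only [Matrix.mul_apply, transpose_apply, O₁, submatrix_apply, id_eq]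
    exact sum_castLE hrd (fun j => O j a * O j b) fun j hj => by rw [hO0 j a hj, zero_mul]
  have hO₁' : O₁ * O₁ᵀ = 1 := mul_eq_one_comm.mp hO₁
  have hWx : Wᵀ *ᵥ x = 0 := by
    have : Wᵀ *ᵥ (proj W *ᵥ x) = Wᵀ *ᵥ x := by
      rw [mulVec_mulVec, proj, ← Matrix.mul_assoc, hW, Matrix.one_mul]
    rw [← this, hx, mulVec_zero]
  have hOx : O₁ᵀ *ᵥ (fun k => (Qᵀ *ᵥ x) (Fin.castLE hrd k)) = 0 := by
    have h6 : Oᵀ *ᵥ (Qᵀ *ᵥ x) = 0 := by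
      rw [hO, transpose_mul, transpose_transpose, mulVec_mulVec, Matrix.mul_assoc, hQ,
        Matrix.mul_one, hWx]
    rw [← h6]
    ext a
    simp only [mulVec, dotProduct, transpose_apply, O₁, submatrix_apply, id_eq]
    exact sum_castLE hrd (fun j => O j a * ∑ i, Q i j * x i) fun j hj => by
      rw [hO0 j a hj, zero_mul]
  have hlow : ∀ j : Fin d, j.val < r → (Qᵀ *ᵥ x) j = 0 := by
    intro j hj
    have h7 : (fun k => (Qᵀ *ᵥ x) (Fin.castLE hrd k)) = 0 := by
      rw [← one_mulVec (fun k => (Qᵀ *ᵥ x) (Fin.castLE hrd k)), ← hO₁', ← mulVec_mulVec, hOx,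
        mulVec_zero]
    exact congrFun h7 ⟨j.val, hj⟩
  rw [quadratic_eq_sum hQ hAQ, dotProduct_self_eq_sum hQ, Finset.mul_sum]
  refine Finset.sum_le_sum fun j _ => ?_
  rcases lt_or_ge j.val r with hj | hj
  · simp [hlow j hj]
  · exact mul_le_mul_of_nonneg_right
      (sortedEigenvalue_le hA (by omega) (by omega) (by omega)) (sq_nonneg _)

lemma IsTopEigenspaceProjection.isStarProjection (h : IsTopEigenspaceProjection A r P) :
    IsStarProjection P := by
  obtain ⟨W, hW, -, rfl⟩ := h
  exact isStarProjection_proj hW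

lemma IsTopEigenspaceProjection.commute (h : IsTopEigenspaceProjection A r P)
    (hA : A.IsHermitian) : P * A = A * P := by
  obtain ⟨W, -, hAW, rfl⟩ := h
  have hAt : Aᵀ = A := by rw [← conjTranspose_eq_transpose_of_trivial]; exact hA
  have h2 := congrArg transpose hAW
  rw [transpose_mul, transpose_mul, hAt, diagonal_transpose] at h2
  rw [proj, Matrix.mul_assoc, h2, ← Matrix.mul_assoc, ← Matrix.mul_assoc, hAW]

lemma IsTopEigenspaceProjection.sub_posSemidef (h : IsTopEigenspaceProjection A r P)
    (hA : A.IsHermitian) (hrd : r ≤ d) {a : ℝ} (ha : a ≤ sortedEigenvalue A r) :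
    (A * P - a • P).PosSemidef := by
  obtain ⟨W, -, hAW, rfl⟩ := h
  have hD : (diagonal (fun k : Fin r => sortedEigenvalue A (k.val + 1) - a)).PosSemidef :=
    PosSemidef.diagonal fun k => sub_nonneg.mpr
      (ha.trans (sortedEigenvalue_le hA (by omega) (by omega) hrd))
  have h2 := hD.mul_mul_conjTranspose_same W
  rw [conjTranspose_eq_transpose_of_trivial] at h2
  convert h2 using 1
  rw [← diagonal_sub, Matrix.mul_sub, Matrix.sub_mul, ← hAW, proj, Matrix.mul_assoc]
  congr 1
  rw [← smul_one_eq_diagonal, Matrix.mul_smul, Matrix.mul_one, Matrix.smul_mul]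

/-- The part of `A` outside its top eigenspace is bounded by any nonnegative bound of the next
eigenvalue. -/
lemma IsTopEigenspaceProjection.compl_posSemidef (h : IsTopEigenspaceProjection A r P)
    (hA : A.IsHermitian) (hgap : sortedEigenvalue A (r + 1) < sortedEigenvalue A r)
    {m : ℝ} (hm : sortedEigenvalue A (r + 1) ≤ m) (hm0 : 0 ≤ m) :
    (m • (1 : Matrix (Fin d) (Fin d) ℝ) - A * (1 - P)).PosSemidef := by
  have hP := h.isStarProjection
  have hc := h.commute hA
  have hsand : A * (1 - P) = (1 - P) * A * (1 - P) := by
    rw [Matrix.sub_mul, Matrix.one_mul, hc, Matrix.sub_mul, Matrix.mul_assoc A P,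
      hP.mul_one_sub_self, Matrix.mul_zero, sub_zero]
  have hH : (A * (1 - P)).IsHermitian := by
    rw [hsand]
    have := isHermitian_mul_mul_conjTranspose (1 - P) hA
    rwa [conjTranspose_eq_transpose_of_trivial, hP.one_sub.transpose_eq] at this
  refine posSemidef_of_quadratic ((isHermitian_one.smul (by simp [IsSelfAdjoint])).sub hH)
    fun x => ?_
  rw [sub_mulVec, dotProduct_sub, smul_mulVec, one_mulVec, dotProduct_smul, smul_eq_mul,
    sub_nonneg, hsand, ← mulVec_mulVec, ← mulVec_mulVec, dotProduct_mulVec, ← mulVec_transpose,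
    hP.one_sub.transpose_eq]
  have h0 : P *ᵥ ((1 - P) *ᵥ x) = 0 := by
    rw [mulVec_mulVec, hP.mul_one_sub_self, zero_mulVec]
  refine (h.quadratic_le hA hgap h0).trans ?_
  have h1 : 0 ≤ x ⬝ᵥ P *ᵥ x := by simpa using hP.matrix_posSemidef.dotProduct_mulVec_nonneg x
  have h2 : ((1 - P) *ᵥ x) ⬝ᵥ ((1 - P) *ᵥ x) = x ⬝ᵥ x - x ⬝ᵥ P *ᵥ x := by
    rw [dotProduct_mulVec, ← mulVec_transpose, hP.one_sub.transpose_eq, mulVec_mulVec,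
      hP.one_sub.isIdempotentElem.eq, sub_mulVec, one_mulVec, sub_dotProduct,
      dotProduct_comm (P *ᵥ x)]
  have h3 : 0 ≤ ((1 - P) *ᵥ x) ⬝ᵥ ((1 - P) *ᵥ x) := Finset.sum_nonneg fun i _ => mul_self_nonneg _
  -- `A * (1 - P)` vanishes on the range of `P`, so comparison with m on the whole space requires m
  -- ≥ 0.
  refine (mul_le_mul_of_nonneg_right hm h3).trans (mul_le_mul_of_nonneg_left ?_ hm0)
  linarith

end TopEigenspace

/-- Two matrices with product zero that are bounded by `m` have a sum bounded by `m`. -/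
lemma smul_one_sub_add_posSemidef {d : ℕ} {A B : Matrix (Fin d) (Fin d) ℝ}
    (hA : A.IsHermitian) (hB : B.IsHermitian) (hAB : A * B = 0) {m : ℝ} (hm : 0 ≤ m)
    (hAm : (m • (1 : Matrix (Fin d) (Fin d) ℝ) - A).PosSemidef)
    (hBm : (m • (1 : Matrix (Fin d) (Fin d) ℝ) - B).PosSemidef) :
    (m • (1 : Matrix (Fin d) (Fin d) ℝ) - (A + B)).PosSemidef := by
  have hBA : B * A = 0 := by
    have := congrArg conjTranspose hAB
    rwa [conjTranspose_mul, hA.eq, hB.eq, conjTranspose_zero] at this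
  have key : ∀ {A : Matrix (Fin d) (Fin d) ℝ} {l : ℝ} {z : Fin d → ℝ},
      (m • (1 : Matrix (Fin d) (Fin d) ℝ) - A).PosSemidef → m < l → A *ᵥ z = l • z → z = 0 := by
    intro A l z hAm hl hz
    have h1 : 0 ≤ z ⬝ᵥ (m • (1 : Matrix (Fin d) (Fin d) ℝ) - A) *ᵥ z := by
      simpa using hAm.dotProduct_mulVec_nonneg z
    rw [sub_mulVec, smul_mulVec, one_mulVec, hz, ← sub_smul, dotProduct_smul, smul_eq_mul] at h1
    have h2 : 0 ≤ z ⬝ᵥ z := Finset.sum_nonneg fun i _ => mul_self_nonneg _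
    have h3 : z ⬝ᵥ z = 0 := by nlinarith
    exact dotProduct_self_eq_zero.mp h3
  have hH : (A + B).IsHermitian := hA.add hB
  obtain ⟨Q, hQ', hQ, hTQ⟩ := exists_sorted_diagonalization hH
  refine posSemidef_of_quadratic ((isHermitian_one.smul (by simp [IsSelfAdjoint])).sub hH)
    fun x => ?_
  rw [sub_mulVec, dotProduct_sub, quadratic_eq_sum hQ hTQ, smul_mulVec, one_mulVec,
    dotProduct_smul, dotProduct_self_eq_sum hQ, smul_eq_mul, Finset.mul_sum, sub_nonneg]
  refine Finset.sum_le_sum fun j _ => mul_le_mul_of_nonneg_right ?_ (sq_nonneg _)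
  by_contra! hlt
  set l := sortedEigenvalue (A + B) (j.val + 1) with hl
  set q : Fin d → ℝ := fun i => Q i j with hq
  have hTq : (A + B) *ᵥ q = l • q := by
    ext i
    have := congrFun (congrFun hTQ i) j
    rw [mul_diagonal, Matrix.mul_apply] at this
    simpa [mulVec, dotProduct, hq, mul_comm l] using this
  -- From AB = 0 follows A(Aq) = A(A + B)q = l·Aq with l > m, so Aq vanishes; likewise Bq. Then lq =
  -- 0 with l > m ≥ 0 contradicts that q is a unit vector.
  have hAq : A *ᵥ q = 0 := key hAm hlt (by
    rw [← mulVec_smul, ← hTq, mulVec_mulVec, mulVec_mulVec, Matrix.mul_add, hAB, add_zero])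
  have hBq : B *ᵥ q = 0 := key hBm hlt (by
    rw [← mulVec_smul, ← hTq, mulVec_mulVec, mulVec_mulVec, Matrix.mul_add, hBA, zero_add])
  rw [add_mulVec, hAq, hBq, add_zero] at hTq
  have hq0 : q = 0 := by
    rcases smul_eq_zero.mp hTq.symm with h | h
    · linarith
    · exact h
  have h1 := congrFun (congrFun hQ' j) j
  rw [Matrix.mul_apply, one_apply_eq] at h1
  have h2 : ∀ i, Q i j = 0 := congrFun hq0
  simp [h2] at h1

/-! ### Frobenius norm and curvature of trace functionals -/

lemma sq_norm_eq_trace {m n : Type*} [Fintype m] [Fintype n] (M : Matrix m n ℝ) :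
    ‖M‖ ^ 2 = (Mᵀ * M).trace := by
  rw [frobenius_norm_def, ← Real.sqrt_eq_rpow, Real.sq_sqrt
    (Finset.sum_nonneg fun i _ => Finset.sum_nonneg fun j _ => by positivity)]
  simp only [trace, diag_apply, Matrix.mul_apply, transpose_apply]
  rw [Finset.sum_comm]
  refine Finset.sum_congr rfl fun i _ => Finset.sum_congr rfl fun j _ => ?_
  rw [Real.rpow_two, Real.norm_eq_abs, sq_abs, sq]

/-- Young's inequality, from the square of (1/c)M - K/2. With c = δ the `K` term is half of the
curvature δ/2 and can be absorbed. -/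
lemma trace_transpose_mul_le {m n : Type*} [Fintype m] [Fintype n] (M K : Matrix m n ℝ) {c : ℝ}
    (hc : 0 < c) : (Mᵀ * K).trace ≤ 1 / c * ‖M‖ ^ 2 + c / 4 * ‖K‖ ^ 2 := by
  have h : 0 ≤ ‖(1 / c) • M - (1 / 2 : ℝ) • K‖ ^ 2 := sq_nonneg _
  have hKM : (Kᵀ * M).trace = (Mᵀ * K).trace := by
    rw [← trace_transpose, transpose_mul, transpose_transpose]
  rw [sq_norm_eq_trace, transpose_sub, Matrix.sub_mul, Matrix.mul_sub, Matrix.mul_sub] at h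
  simp only [transpose_smul, Matrix.smul_mul, Matrix.mul_smul, trace_sub, trace_smul, smul_eq_mul,
    hKM, ← sq_norm_eq_trace] at h
  have h2 := mul_nonneg hc.le h
  have h3 : c * (1 / c * (1 / c * ‖M‖ ^ 2) - 1 / 2 * (1 / c * (Mᵀ * K).trace)
      - (1 / c * (1 / 2 * (Mᵀ * K).trace) - 1 / 2 * (1 / 2 * ‖K‖ ^ 2)))
      = 1 / c * ‖M‖ ^ 2 - (Mᵀ * K).trace + c / 4 * ‖K‖ ^ 2 := by
    field_simp
    ring
  linarith

/-- Idempotence removes the quadratic terms, so distances between projections are governed by the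
linear trace pairings that semidefinite bounds control. -/
lemma sq_norm_proj_sub {n : Type*} [Fintype n] {P Q : Matrix n n ℝ} (hP : IsStarProjection P)
    (hQ : IsStarProjection Q) : ‖P - Q‖ ^ 2 = P.trace + Q.trace - 2 * (P * Q).trace := by
  rw [sq_norm_eq_trace, transpose_sub, hP.transpose_eq, hQ.transpose_eq, Matrix.sub_mul,
    Matrix.mul_sub, Matrix.mul_sub, hP.isIdempotentElem.eq, hQ.isIdempotentElem.eq, trace_sub,
    trace_sub, trace_sub, trace_mul_comm Q P]
  ring

/-- Strong concavity of the linear trace functional on projections at the top eigenspace. -/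
lemma curvature {d : ℕ} {A R R₀ : Matrix (Fin d) (Fin d) ℝ} (hR : IsStarProjection R)
    (hR₀ : IsStarProjection R₀) (htr : R.trace = R₀.trace) {a m : ℝ}
    (hlow : (A * R₀ - a • R₀).PosSemidef)
    (hup : (m • (1 - R₀) - A * (1 - R₀)).PosSemidef) :
    (a - m) / 2 * ‖R - R₀‖ ^ 2 ≤ (A * (R₀ - R)).trace := by
  -- The lower bound is tested on 1 - R and the upper bound on R. Equal traces give tr(R₀(1 - R)) =
  -- tr((1 - R₀)R) = ‖R - R₀‖²/2, and the terms tr(A R₀ R) cancel in the difference.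
  have h1 := trace_mul_nonneg hlow hR.one_sub
  have h2 := trace_mul_nonneg hup hR
  rw [sq_norm_proj_sub hR hR₀]
  simp only [Matrix.sub_mul, Matrix.mul_sub, Matrix.mul_one, Matrix.one_mul, trace_sub,
    Matrix.smul_mul, trace_smul, smul_eq_mul] at h1 h2 ⊢
  rw [trace_mul_comm R₀ R] at h1 h2
  rw [htr] at h2 ⊢
  linarith

lemma mul_eq_zero_of_colSubset {d : ℕ} {A B P : Matrix (Fin d) (Fin d) ℝ} (h : ColSubset P A)
    (hBA : B * A = 0) : B * P = 0 := by
  refine Matrix.toLin'.injective (LinearMap.ext fun x => ?_)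
  obtain ⟨z, hz⟩ : P *ᵥ x ∈ LinearMap.range A.mulVecLin := h ⟨x, rfl⟩
  rw [mulVecLin_apply] at hz
  rw [toLin'_apply, ← mulVec_mulVec, ← hz, mulVec_mulVec, hBA, zero_mulVec, map_zero,
    LinearMap.zero_apply]

/-- Compression of `X ≤ m` to the range of a projection that carries `X`. -/
lemma smul_sub_posSemidef_of_carrier {d : ℕ} {X E : Matrix (Fin d) (Fin d) ℝ} {m : ℝ}
    (h : (m • (1 : Matrix (Fin d) (Fin d) ℝ) - X).PosSemidef) (hE : IsStarProjection E)
    (hEX : E * X = X) (hXE : X * E = X) : (m • E - X).PosSemidef := by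
  have h1 := h.mul_mul_conjTranspose_same E
  rw [conjTranspose_eq_transpose_of_trivial, hE.transpose_eq, Matrix.mul_sub, hEX,
    Matrix.sub_mul, hXE, Matrix.mul_smul, Matrix.mul_one, Matrix.smul_mul,
    hE.isIdempotentElem.eq] at h1
  exact h1

/-! ### Population curvature for one client -/

section Client

variable {d r₁ r₂ : ℕ} {S Sg Sl : Matrix (Fin d) (Fin d) ℝ} {P₀ Q₀ : Matrix (Fin d) (Fin d) ℝ}

lemma IsOrthogonalDirectSum.mul_eq_zero' (h : IsOrthogonalDirectSum S Sg Sl) : Sl * Sg = 0 := by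
  have := congrArg transpose h.mul_eq_zero
  rwa [transpose_mul, h.symm_left.eq, h.symm_right.eq, transpose_zero] at this

lemma IsOrthogonalDirectSum.proj_mul_eq_zero (h : IsOrthogonalDirectSum S Sg Sl)
    (hP₀ : IsStarProjection P₀) (hg : ColSubset P₀ Sg) (hl : ColSubset Q₀ Sl) : P₀ * Q₀ = 0 := by
  refine mul_eq_zero_of_colSubset hl ?_
  have := congrArg transpose (mul_eq_zero_of_colSubset hg h.mul_eq_zero')
  rwa [transpose_mul, h.symm_right.eq, hP₀.transpose_eq, transpose_zero] at this

lemma isHermitian_of_isSymm {A : Matrix (Fin d) (Fin d) ℝ} (h : A.IsSymm) : A.IsHermitian := by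
  rw [IsHermitian, conjTranspose_eq_transpose_of_trivial, h.eq]

lemma mul_eq_zero_comm_of_isStarProjection {P Q : Matrix (Fin d) (Fin d) ℝ}
    (hP : IsStarProjection P) (hQ : IsStarProjection Q) (h : P * Q = 0) : Q * P = 0 := by
  have := congrArg transpose h
  rwa [transpose_mul, hP.transpose_eq, hQ.transpose_eq, transpose_zero] at this

lemma isStarProjection_add {P Q : Matrix (Fin d) (Fin d) ℝ}
    (hP : IsStarProjection P) (hQ : IsStarProjection Q) (h : P * Q = 0) :
    IsStarProjection (P + Q) where
  isIdempotentElem := by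
    rw [IsIdempotentElem, Matrix.add_mul, Matrix.mul_add, Matrix.mul_add, h,
      mul_eq_zero_comm_of_isStarProjection hP hQ h, hP.isIdempotentElem.eq,
      hQ.isIdempotentElem.eq, add_zero, zero_add]
  isSelfAdjoint := hP.isSelfAdjoint.add hQ.isSelfAdjoint

/-- The population curvature of one client. -/
lemma client_curvature (h : IsOrthogonalDirectSum S Sg Sl)
    (hg : ColSubset P₀ Sg) (hl : ColSubset Q₀ Sl)
    (htg : IsTopEigenspaceProjection Sg r₁ P₀) (htl : IsTopEigenspaceProjection Sl r₂ Q₀)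
    (hrd₁ : r₁ ≤ d) (hrd₂ : r₂ ≤ d) (hQ0 : Q₀ ≠ 0) {δ : ℝ} (hδ : 0 < δ)
    (hgap : δ ≤ min (sortedEigenvalue Sg r₁) (sortedEigenvalue Sl r₂)
      - max (sortedEigenvalue Sg (r₁ + 1)) (sortedEigenvalue Sl (r₂ + 1)))
    {R : Matrix (Fin d) (Fin d) ℝ} (hR : IsStarProjection R)
    (htr : R.trace = (P₀ + Q₀).trace) :
    δ / 2 * ‖R - (P₀ + Q₀)‖ ^ 2 ≤ (S * ((P₀ + Q₀) - R)).trace := by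
  set a := min (sortedEigenvalue Sg r₁) (sortedEigenvalue Sl r₂) with ha
  set m := max (sortedEigenvalue Sg (r₁ + 1)) (sortedEigenvalue Sl (r₂ + 1)) with hm
  have hag : a ≤ sortedEigenvalue Sg r₁ := min_le_left _ _
  have hal : a ≤ sortedEigenvalue Sl r₂ := min_le_right _ _
  have hmg : sortedEigenvalue Sg (r₁ + 1) ≤ m := le_max_left _ _
  have hml : sortedEigenvalue Sl (r₂ + 1) ≤ m := le_max_right _ _
  have hHg := isHermitian_of_isSymm h.symm_left
  have hHl := isHermitian_of_isSymm h.symm_right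
  have hP := htg.isStarProjection
  have hQ := htl.isStarProjection
  have hPQ : P₀ * Q₀ = 0 := h.proj_mul_eq_zero hP hg hl
  have hQP := mul_eq_zero_comm_of_isStarProjection hP hQ hPQ
  have hSgQ : Sg * Q₀ = 0 := mul_eq_zero_of_colSubset hl h.mul_eq_zero
  have hSlP : Sl * P₀ = 0 := mul_eq_zero_of_colSubset hg h.mul_eq_zero'
  have hR₀ := isStarProjection_add hP hQ hPQ
  -- No semidefiniteness of `Sg` is assumed. A nonzero vector in the range of `Q₀` is killed by `Sg`
  -- and orthogonal to `P₀`, so the value 0 of the form is at most λ_{r₁+1}(Sg) times a positive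
  -- number.
  have hm0 : 0 ≤ m := by
    obtain ⟨x, hx⟩ : ∃ x : Fin d → ℝ, Q₀ *ᵥ x ≠ 0 := by
      by_contra! hcon
      exact hQ0 (Matrix.toLin'.injective (LinearMap.ext fun x => by simpa using hcon x))
    have h1 := htg.quadratic_le hHg (by linarith) (x := Q₀ *ᵥ x)
      (by rw [mulVec_mulVec, hPQ, zero_mulVec])
    rw [mulVec_mulVec, hSgQ, zero_mulVec, dotProduct_zero] at h1
    have h2 : 0 ≤ (Q₀ *ᵥ x) ⬝ᵥ (Q₀ *ᵥ x) := Finset.sum_nonneg fun i _ => mul_self_nonneg _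
    have h3 : 0 < (Q₀ *ᵥ x) ⬝ᵥ (Q₀ *ᵥ x) :=
      lt_of_le_of_ne h2 fun h0 => hx (dotProduct_self_eq_zero.mp h0.symm)
    exact (nonneg_of_mul_nonneg_left h1 h3).trans hmg
  have hA := htg.compl_posSemidef hHg (by linarith) hmg hm0
  have hB := htl.compl_posSemidef hHl (by linarith) hml hm0
  have hHA : (Sg * (1 - P₀)).IsHermitian := by
    have := (isHermitian_one.smul (k := m) (by simp [IsSelfAdjoint])).sub hA.isHermitian
    rwa [sub_sub_cancel] at this
  have hHB : (Sl * (1 - Q₀)).IsHermitian := by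
    have := (isHermitian_one.smul (k := m) (by simp [IsSelfAdjoint])).sub hB.isHermitian
    rwa [sub_sub_cancel] at this
  have hAB : Sg * (1 - P₀) * (Sl * (1 - Q₀)) = 0 := by
    have hPSl : P₀ * Sl = 0 := by
      have := congrArg transpose hSlP
      rwa [transpose_mul, h.symm_right.eq, hP.transpose_eq, transpose_zero] at this
    rw [Matrix.mul_assoc, ← Matrix.mul_assoc (1 - P₀), Matrix.sub_mul, hPSl, Matrix.one_mul,
      sub_zero, ← Matrix.mul_assoc, h.mul_eq_zero, Matrix.zero_mul]
  -- The two remainders have product zero, so their sum is bounded by m and not merely by 2m.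
  have hT := smul_one_sub_add_posSemidef hHA hHB hAB hm0 hA hB
  have hTeq : Sg * (1 - P₀) + Sl * (1 - Q₀) = S * (1 - (P₀ + Q₀)) := by
    rw [h.eq_add]
    simp only [Matrix.add_mul, Matrix.mul_sub, Matrix.mul_add, Matrix.mul_one, hSgQ, hSlP]
    abel
  rw [hTeq] at hT
  have hup : (m • (1 - (P₀ + Q₀)) - S * (1 - (P₀ + Q₀))).PosSemidef := by
    have hcomm : (P₀ + Q₀) * S = S * (P₀ + Q₀) := by
      have h2 := htg.commute hHg
      have h3 := htl.commute hHl
      have hQSg : Q₀ * Sg = 0 := by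
        have := congrArg transpose hSgQ
        rwa [transpose_mul, h.symm_left.eq, hQ.transpose_eq, transpose_zero] at this
      have hPSl : P₀ * Sl = 0 := by
        have := congrArg transpose hSlP
        rwa [transpose_mul, h.symm_right.eq, hP.transpose_eq, transpose_zero] at this
      rw [h.eq_add]
      simp only [Matrix.add_mul, Matrix.mul_add, hSgQ, hSlP, hQSg, hPSl, h2, h3]
    have hi := hR₀.one_sub.isIdempotentElem.eq
    have hc' : (1 - (P₀ + Q₀)) * S = S * (1 - (P₀ + Q₀)) := by
      rw [Matrix.sub_mul, Matrix.mul_sub, hcomm, Matrix.one_mul, Matrix.mul_one]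
    exact smul_sub_posSemidef_of_carrier hT hR₀.one_sub
      (by rw [← Matrix.mul_assoc, hc', Matrix.mul_assoc, hi]) (by rw [Matrix.mul_assoc, hi])
  have hlow : (S * (P₀ + Q₀) - a • (P₀ + Q₀)).PosSemidef := by
    have h1 := (htg.sub_posSemidef hHg hrd₁ hag).add (htl.sub_posSemidef hHl hrd₂ hal)
    convert h1 using 1
    rw [h.eq_add]
    simp only [Matrix.add_mul, Matrix.mul_add, hSgQ, hSlP, smul_add]
    abel
  refine le_trans ?_ (curvature hR hR₀ htr hlow hup)
  gcongr

end Client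

/-! ### Separating global from local errors -/

/-- Identifiability: the combined projections determine the individual ones. -/
lemma identifiability {d N : ℕ} (hN : 0 < N) {P P₀ : Matrix (Fin d) (Fin d) ℝ}
    {Q Q₀ : Fin N → Matrix (Fin d) (Fin d) ℝ} (hP : IsStarProjection P)
    (hP₀ : IsStarProjection P₀) (hQ : ∀ i, IsStarProjection (Q i))
    (hQ₀ : ∀ i, IsStarProjection (Q₀ i)) (hPQ : ∀ i, P * Q i = 0) (hPQ₀ : ∀ i, P₀ * Q₀ i = 0)
    (htr : P.trace = P₀.trace) (htr' : ∀ i, (Q i).trace = (Q₀ i).trace) {θ : ℝ} (hθ : 0 < θ)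
    (hθ₁ : θ < 1) (hid : maxEigenvalue ((1 / (N : ℝ)) • ∑ i, Q₀ i) ≤ 1 - θ) :
    ‖P - P₀‖ ^ 2 + (1 / (N : ℝ)) * ∑ i, ‖Q i - Q₀ i‖ ^ 2 ≤
      5 / θ * ((1 / (N : ℝ)) * ∑ i, ‖P + Q i - (P₀ + Q₀ i)‖ ^ 2) := by
  set Qm : Matrix (Fin d) (Fin d) ℝ := (1 / (N : ℝ)) • ∑ i, Q₀ i with hQm
  have hN' : (0 : ℝ) < N := by exact_mod_cast hN
  have hPSD : Qm.PosSemidef :=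
    (posSemidef_sum _ fun i _ => (hQ₀ i).matrix_posSemidef).smul (by positivity)
  have hmax := maxEigenvalue_smul_one_sub_posSemidef hPSD.isHermitian
  have hmax' : ((1 - θ) • (1 : Matrix (Fin d) (Fin d) ℝ) - Qm).PosSemidef := by
    have := hmax.add ((PosSemidef.one (n := Fin d) (R := ℝ)).smul (sub_nonneg.mpr hid))
    convert this using 1
    module
  have hPm : P₀ * Qm = 0 := by
    rw [hQm, Matrix.mul_smul, Matrix.mul_sum, Finset.sum_eq_zero fun i _ => hPQ₀ i, smul_zero]
  have hmP : Qm * P₀ = 0 := by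
    have := congrArg transpose hPm
    have hs : Qmᵀ = Qm := by rw [← conjTranspose_eq_transpose_of_trivial]; exact hPSD.isHermitian
    rwa [transpose_mul, hs, hP₀.transpose_eq, transpose_zero] at this
  -- `Qm` lives on the complement of `P₀`, so 1 may be replaced by 1 - P₀; its pairing with `P` is
  -- ‖P - P₀‖²/2 because the traces agree.
  have hmax'' : ((1 - θ) • (1 - P₀) - Qm).PosSemidef :=
     smul_sub_posSemidef_of_carrier hmax' hP₀.one_sub
      (by rw [Matrix.sub_mul, hPm, Matrix.one_mul, sub_zero])
      (by rw [Matrix.mul_sub, hmP, Matrix.mul_one, sub_zero])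
  -- the global part of the cross term
  have hcross₁ : (Qm * P).trace ≤ (1 - θ) * (‖P - P₀‖ ^ 2 / 2) := by
    have h1 := trace_mul_nonneg hmax'' hP
    rw [sq_norm_proj_sub hP hP₀]
    simp only [Matrix.sub_mul, Matrix.one_mul, trace_sub, Matrix.smul_mul, trace_smul,
      smul_eq_mul] at h1
    rw [trace_mul_comm P₀ P] at h1
    nlinarith
  have hQmP : (Qm * P).trace = (1 / (N : ℝ)) * ∑ i, (Q₀ i * P).trace := by
    rw [hQm, Matrix.smul_mul, trace_smul, Matrix.sum_mul, trace_sum, smul_eq_mul]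
  -- the local part of the cross term
  have hcross₂ : ∀ i, (P₀ * Q i).trace ≤ ‖Q i - Q₀ i‖ ^ 2 / 2 := by
    intro i
    -- P₀ + Q₀ᵢ is a projection, hence at most 1, and tr((1 - Q₀ᵢ)Qᵢ) = ‖Qᵢ - Q₀ᵢ‖²/2.
    have h1 := trace_mul_nonneg
      (isStarProjection_add hP₀ (hQ₀ i) (hPQ₀ i)).one_sub.matrix_posSemidef (hQ i)
    rw [sq_norm_proj_sub (hQ i) (hQ₀ i)]
    simp only [Matrix.sub_mul, Matrix.add_mul, Matrix.one_mul, trace_sub, trace_add] at h1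
    rw [trace_mul_comm (Q₀ i) (Q i)] at h1
    linarith [htr' i]
  have hexp : ∀ i, ‖P + Q i - (P₀ + Q₀ i)‖ ^ 2 = ‖P - P₀‖ ^ 2 + ‖Q i - Q₀ i‖ ^ 2
      - 2 * (Q₀ i * P).trace - 2 * (P₀ * Q i).trace := by
    intro i
    rw [sq_norm_proj_sub (isStarProjection_add hP (hQ i) (hPQ i))
      (isStarProjection_add hP₀ (hQ₀ i) (hPQ₀ i)), sq_norm_proj_sub hP hP₀,
      sq_norm_proj_sub (hQ i) (hQ₀ i)]
    simp only [Matrix.add_mul, Matrix.mul_add, trace_add]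
    rw [trace_mul_comm P (Q₀ i), trace_mul_comm (Q i) P₀]
    ring
  -- The cross term with `P₀` can consume all of ‖Qᵢ - Q₀ᵢ‖², but the averaged one consumes at most
  -- the fraction 1 - θ of ‖P - P₀‖².
  have hA : θ * ‖P - P₀‖ ^ 2 ≤ (1 / (N : ℝ)) * ∑ i, ‖P + Q i - (P₀ + Q₀ i)‖ ^ 2 := by
    have h1 : ∑ i, (‖P - P₀‖ ^ 2 - 2 * (Q₀ i * P).trace) ≤
        ∑ i, ‖P + Q i - (P₀ + Q₀ i)‖ ^ 2 :=
      Finset.sum_le_sum fun i _ => by rw [hexp i]; linarith [hcross₂ i]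
    have h2 := mul_le_mul_of_nonneg_left h1 (by positivity : (0 : ℝ) ≤ 1 / N)
    refine le_trans ?_ h2
    rw [Finset.sum_sub_distrib, ← Finset.mul_sum, Finset.sum_const, Finset.card_univ,
      Fintype.card_fin, nsmul_eq_mul]
    have h3 : 1 / (N : ℝ) * (N * ‖P - P₀‖ ^ 2 - 2 * ∑ i, (Q₀ i * P).trace)
        = ‖P - P₀‖ ^ 2 - 2 * (Qm * P).trace := by
      rw [hQmP]
      field_simp
    rw [h3]
    linarith
  have hB : (1 / (N : ℝ)) * ∑ i, ‖Q i - Q₀ i‖ ^ 2 ≤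
      2 * ((1 / (N : ℝ)) * ∑ i, ‖P + Q i - (P₀ + Q₀ i)‖ ^ 2) + 2 * ‖P - P₀‖ ^ 2 := by
    have h1 : ∑ i, ‖Q i - Q₀ i‖ ^ 2 ≤
        ∑ i, (2 * ‖P + Q i - (P₀ + Q₀ i)‖ ^ 2 + 2 * ‖P - P₀‖ ^ 2) := by
      refine Finset.sum_le_sum fun i _ => ?_
      have h2 : ‖Q i - Q₀ i‖ ≤ ‖P + Q i - (P₀ + Q₀ i)‖ + ‖P - P₀‖ := by
        have := norm_sub_le (P + Q i - (P₀ + Q₀ i)) (P - P₀)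
        rwa [show P + Q i - (P₀ + Q₀ i) - (P - P₀) = Q i - Q₀ i by abel] at this
      have h3 := norm_nonneg (Q i - Q₀ i)
      nlinarith [sq_nonneg (‖P + Q i - (P₀ + Q₀ i)‖ - ‖P - P₀‖)]
    have h2 := mul_le_mul_of_nonneg_left h1 (by positivity : (0 : ℝ) ≤ 1 / N)
    refine h2.trans_eq ?_
    rw [Finset.sum_add_distrib, ← Finset.mul_sum, Finset.sum_const, Finset.card_univ,
      Fintype.card_fin, nsmul_eq_mul]
    field_simp
  set X := (1 / (N : ℝ)) * ∑ i, ‖P + Q i - (P₀ + Q₀ i)‖ ^ 2 with hX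
  have hX0 : 0 ≤ X := by positivity
  have hC : ‖P - P₀‖ ^ 2 ≤ X / θ := by
    rw [le_div_iff₀ hθ]
    linarith
  have hD : 2 * X ≤ 2 * (X / θ) := by
    have : X ≤ X / θ := le_div_self hX0 hθ hθ₁.le
    linarith
  -- The global error counts once directly and twice through `hB`, giving 3X/θ; the remaining 2X is
  -- at most 2X/θ.
  calc _ ≤ 5 * (X / θ) := by linarith
    _ = _ := by ring

/-! ### The deterministic perturbation bound -/

lemma objective_eq {d r₁ N : ℕ} {r₂ : Fin N → ℕ} (S : Fin N → Matrix (Fin d) (Fin d) ℝ)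
    (U : Matrix (Fin d) (Fin r₁) ℝ) (V : ∀ i, Matrix (Fin d) (Fin (r₂ i)) ℝ) :
    objective S U V = (1 / 2) * ∑ i, (S i * (proj U + proj (V i))).trace := by
  have key : ∀ {r : ℕ} (A : Matrix (Fin d) (Fin d) ℝ) (W : Matrix (Fin d) (Fin r) ℝ),
      (Wᵀ * A * W).trace = (A * proj W).trace := fun A W => by
    rw [Matrix.mul_assoc, trace_mul_comm, proj, Matrix.mul_assoc]
  simp only [objective, key, Matrix.mul_add, trace_add]

lemma proj_mul_proj_eq_zero {d r s : ℕ} {U : Matrix (Fin d) (Fin r) ℝ}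
    {V : Matrix (Fin d) (Fin s) ℝ} (h : Vᵀ * U = 0) : proj U * proj V = 0 := by
  have h' : Uᵀ * V = 0 := by
    rw [← transpose_transpose V, ← transpose_mul, h, transpose_zero]
  rw [proj, proj, Matrix.mul_assoc, ← Matrix.mul_assoc Uᵀ, h', Matrix.zero_mul, Matrix.mul_zero]

/-- Used to see that the true components satisfy the constraints, so that the maximizer can be
compared with them. -/
lemma transpose_mul_eq_zero_of_proj {d r s : ℕ} {U : Matrix (Fin d) (Fin r) ℝ}
    {V : Matrix (Fin d) (Fin s) ℝ} (hU : Uᵀ * U = 1) (hV : Vᵀ * V = 1)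
    (h : proj V * proj U = 0) : Vᵀ * U = 0 := by
  calc Vᵀ * U = (Vᵀ * V) * Vᵀ * (U * (Uᵀ * U)) := by simp [hU, hV]
    _ = Vᵀ * (proj V * proj U) * U := by simp only [proj, Matrix.mul_assoc]
    _ = 0 := by rw [h, Matrix.mul_zero, Matrix.zero_mul]

lemma proj_ne_zero {d r : ℕ} {W : Matrix (Fin d) (Fin r) ℝ} (hr : 0 < r) (hW : Wᵀ * W = 1) :
    proj W ≠ 0 := by
  intro h
  have := trace_proj hW
  rw [h, trace_zero] at this
  have : r = 0 := by exact_mod_cast this.symm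
  omega

/-- The deterministic perturbation bound for a maximizer of the objective. -/
theorem subspaceError_le {d r₁ N : ℕ} {r₂ : Fin N → ℕ} (hN : 0 < N) (hr₂ : ∀ i, 0 < r₂ i)
    {S A Sg Sl : Fin N → Matrix (Fin d) (Fin d) ℝ}
    {U₀ U : Matrix (Fin d) (Fin r₁) ℝ} {V₀ V : ∀ i, Matrix (Fin d) (Fin (r₂ i)) ℝ}
    (hU₀ : U₀ᵀ * U₀ = 1) (hV₀ : ∀ i, (V₀ i)ᵀ * V₀ i = 1)
    (hS : ∀ i, (S i)ᵀ = S i)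
    (hdecomp : ∀ i, IsOrthogonalDirectSum (A i) (Sg i) (Sl i))
    (hcolg : ∀ i, ColSubset (proj U₀) (Sg i)) (hcoll : ∀ i, ColSubset (proj (V₀ i)) (Sl i))
    (htopg : ∀ i, IsTopEigenspaceProjection (Sg i) r₁ (proj U₀))
    (htopl : ∀ i, IsTopEigenspaceProjection (Sl i) (r₂ i) (proj (V₀ i)))
    {θ : ℝ} (hθ₀ : 0 < θ) (hθ₁ : θ < 1)
    (hident : maxEigenvalue ((1 / (N : ℝ)) • ∑ i, proj (V₀ i)) ≤ 1 - θ)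
    {δ : ℝ} (hδ : 0 < δ)
    (hgap : ∀ i, δ ≤
      min (sortedEigenvalue (Sg i) r₁) (sortedEigenvalue (Sl i) (r₂ i))
        - max (sortedEigenvalue (Sg i) (r₁ + 1)) (sortedEigenvalue (Sl i) (r₂ i + 1)))
    (hopt : IsOptimal S U V) :
    subspaceError U U₀ V V₀ ≤ 20 / (θ * δ ^ 2) * ((1 / (N : ℝ)) * ∑ i, ‖S i - A i‖ ^ 2) := by
  obtain ⟨⟨hU, hV, hVU⟩, hmax⟩ := hopt
  have hP := isStarProjection_proj hU
  have hP₀ := isStarProjection_proj hU₀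
  have hQ := fun i => isStarProjection_proj (hV i)
  have hQ₀ := fun i => isStarProjection_proj (hV₀ i)
  have hPQ := fun i => proj_mul_proj_eq_zero (hVU i)
  have hPQ₀ := fun i => (hdecomp i).proj_mul_eq_zero hP₀ (hcolg i) (hcoll i)
  have hQP₀ := fun i => mul_eq_zero_comm_of_isStarProjection hP₀ (hQ₀ i) (hPQ₀ i)
  have htrP : (proj U).trace = (proj U₀).trace := by rw [trace_proj hU, trace_proj hU₀]
  have htrQ : ∀ i, (proj (V i)).trace = (proj (V₀ i)).trace := fun i => by
    rw [trace_proj (hV i), trace_proj (hV₀ i)]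
  have hN' : (0 : ℝ) < N := by exact_mod_cast hN
  have hobj := hmax U₀ V₀ ⟨hU₀, hV₀, fun i =>
    transpose_mul_eq_zero_of_proj hU₀ (hV₀ i) (hQP₀ i)⟩
  rw [objective_eq, objective_eq] at hobj
  set R := fun i => proj U + proj (V i) with hR
  set R₀ := fun i => proj U₀ + proj (V₀ i) with hR₀
  have hcl : ∀ i, δ / 4 * ‖R i - R₀ i‖ ^ 2 ≤
      1 / δ * ‖S i - A i‖ ^ 2 + ((S i * R₀ i).trace - (S i * R i).trace) := by
    intro i
    have h1 := client_curvature (hdecomp i) (hcolg i) (hcoll i) (htopg i) (htopl i)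
      (le_of_transpose_mul_self_eq_one hU₀) (le_of_transpose_mul_self_eq_one (hV₀ i))
      (proj_ne_zero (hr₂ i) (hV₀ i)) hδ (hgap i)
      (isStarProjection_add hP (hQ i) (hPQ i)) (by rw [trace_add, trace_add, htrP, htrQ i])
    have h2 := trace_transpose_mul_le (S i - A i) (R i - R₀ i) hδ
    have hA : (A i)ᵀ = A i := by
      rw [(hdecomp i).eq_add, transpose_add, (hdecomp i).symm_left.eq, (hdecomp i).symm_right.eq]
    rw [transpose_sub, hS i, hA] at h2
    change δ / 2 * ‖R i - R₀ i‖ ^ 2 ≤ (A i * (R₀ i - R i)).trace at h1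
    simp only [Matrix.sub_mul, Matrix.mul_sub, trace_sub] at h1 h2
    linarith
  -- The trace differences have a sign only after summation, because optimality is a joint statement
  -- about all clients.
  have hsum : δ / 4 * ∑ i, ‖R i - R₀ i‖ ^ 2 ≤ 1 / δ * ∑ i, ‖S i - A i‖ ^ 2 := by
    have h1 := Finset.sum_le_sum fun i (_ : i ∈ Finset.univ) => hcl i
    rw [Finset.sum_add_distrib, Finset.sum_sub_distrib, ← Finset.mul_sum, ← Finset.mul_sum] at h1
    linarith
  have hsum' : ∑ i, ‖R i - R₀ i‖ ^ 2 ≤ 4 / δ ^ 2 * ∑ i, ‖S i - A i‖ ^ 2 := by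
    have h1 := mul_le_mul_of_nonneg_left hsum (by positivity : 0 ≤ 4 / δ)
    calc _ = 4 / δ * (δ / 4 * ∑ i, ‖R i - R₀ i‖ ^ 2) := by field_simp
      _ ≤ _ := h1
      _ = _ := by field_simp
  refine (identifiability hN hP hP₀ hQ hQ₀ hPQ hPQ₀ htrP htrQ hθ₀ hθ₁ hident).trans ?_
  calc 5 / θ * ((1 / (N : ℝ)) * ∑ i, ‖R i - R₀ i‖ ^ 2)
      ≤ 5 / θ * ((1 / (N : ℝ)) * (4 / δ ^ 2 * ∑ i, ‖S i - A i‖ ^ 2)) := by gcongr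
    _ = _ := by field_simp; ring

/-! ### Nets on the sphere and the Frobenius norm -/

/-- A 1/2-separated set of maximal cardinality is a net, since a point far from it could be added.
Doubling its points gives a 1-separated set in the ball of radius 2, to which the volume bound 5^d
applies. -/
lemma exists_sphere_net_norm (d : ℕ) : ∃ T : Finset (EuclideanSpace ℝ (Fin d)),
    T.card ≤ 5 ^ d ∧ (∀ v ∈ T, ‖v‖ = 1) ∧ ∀ x, ‖x‖ = 1 → ∃ v ∈ T, ‖x - v‖ ≤ 1 / 2 := by
  classical
  let p : ℕ → Prop := fun k => ∃ T : Finset (EuclideanSpace ℝ (Fin d)), T.card = k ∧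
    (∀ v ∈ T, ‖v‖ = 1) ∧ ∀ v ∈ T, ∀ w ∈ T, v ≠ w → 1 / 2 ≤ ‖v - w‖
  have hbd : ∀ k, p k → k ≤ 5 ^ d := by
    rintro k ⟨T, rfl, h1, h2⟩
    have hinj : Function.Injective fun v : EuclideanSpace ℝ (Fin d) => (2 : ℝ) • v :=
      smul_right_injective _ two_ne_zero
    rw [← Finset.card_image_of_injective T hinj]
    refine (Besicovitch.card_le_of_separated _ ?_ ?_).trans_eq
      (by rw [finrank_euclideanSpace_fin])
    · intro c hc
      obtain ⟨v, hv, rfl⟩ := Finset.mem_image.mp hc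
      rw [norm_smul, h1 v hv]
      norm_num
    · intro c hc e he hce
      obtain ⟨v, hv, rfl⟩ := Finset.mem_image.mp hc
      obtain ⟨w, hw, rfl⟩ := Finset.mem_image.mp he
      have := h2 v hv w hw fun h => hce (by rw [h])
      rw [← smul_sub, norm_smul, Real.norm_ofNat]
      linarith
  have hp0 : p 0 := ⟨∅, by simp⟩
  obtain ⟨T, hcard, h1, h2⟩ := Nat.findGreatest_spec (Nat.zero_le (5 ^ d)) hp0
  refine ⟨T, hcard ▸ Nat.findGreatest_le _, h1, fun x hx => ?_⟩
  by_contra! hfar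
  have hxT : x ∉ T := fun h => by
    have := hfar x h
    rw [sub_self, norm_zero] at this
    norm_num at this
  have hp : p (T.card + 1) := by
    refine ⟨insert x T, Finset.card_insert_of_notMem hxT, ?_, ?_⟩
    · intro v hv
      rcases Finset.mem_insert.mp hv with rfl | hv
      exacts [hx, h1 v hv]
    · intro v hv w hw hvw
      rcases Finset.mem_insert.mp hv with hv | hv <;> rcases Finset.mem_insert.mp hw with hw | hw
      · exact absurd (hv.trans hw.symm) hvw
      · exact hv ▸ (hfar w hw).le
      · rw [norm_sub_rev]
        exact hw ▸ (hfar v hv).le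
      · exact h2 v hv w hw hvw
  have := Nat.le_findGreatest (hbd _ hp) hp
  omega

/-- The unit sphere has a `1/2`-net of at most `5 ^ d` points. -/
lemma exists_sphere_net (d : ℕ) : ∃ T : Finset (Fin d → ℝ),
    T.card ≤ 5 ^ d ∧ (∀ v ∈ T, v ⬝ᵥ v = 1) ∧
      ∀ x : Fin d → ℝ, x ⬝ᵥ x = 1 → ∃ v ∈ T, (x - v) ⬝ᵥ (x - v) ≤ 1 / 4 := by
  classical
  have hnorm : ∀ v : EuclideanSpace ℝ (Fin d), v.ofLp ⬝ᵥ v.ofLp = ‖v‖ ^ 2 := fun v => by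
    rw [EuclideanSpace.real_norm_sq_eq]
    simp [dotProduct, sq]
  obtain ⟨T, hcard, h1, h2⟩ := exists_sphere_net_norm d
  refine ⟨T.image WithLp.ofLp, Finset.card_image_le.trans hcard, ?_, ?_⟩
  · intro v hv
    obtain ⟨w, hw, rfl⟩ := Finset.mem_image.mp hv
    rw [hnorm, h1 w hw, one_pow]
  · intro x hx
    have hx' : ‖WithLp.toLp 2 x‖ = 1 := by
      have := hnorm (WithLp.toLp 2 x)
      rw [hx] at this
      exact (pow_eq_one_iff_of_nonneg (norm_nonneg _) two_ne_zero).mp this.symm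
    obtain ⟨v, hv, hxv⟩ := h2 _ hx'
    refine ⟨v.ofLp, Finset.mem_image_of_mem _ hv, ?_⟩
    have := hnorm (WithLp.toLp 2 x - v)
    rw [WithLp.ofLp_sub] at this
    rw [this]
    have h3 := norm_nonneg (WithLp.toLp 2 x - v)
    nlinarith

/-- The Frobenius norm of a symmetric matrix is controlled by its quadratic form on a net. -/
lemma sq_norm_le_of_net {d : ℕ} {T : Finset (Fin d → ℝ)} (hT : ∀ v ∈ T, v ⬝ᵥ v = 1)
    (hnet : ∀ x : Fin d → ℝ, x ⬝ᵥ x = 1 → ∃ v ∈ T, (x - v) ⬝ᵥ (x - v) ≤ 1 / 4)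
    {M : Matrix (Fin d) (Fin d) ℝ} (hM : M.IsHermitian) {t : ℝ}
    (ht : ∀ v ∈ T, |v ⬝ᵥ M *ᵥ v| ≤ t) : ‖M‖ ^ 2 ≤ d * (32 * t) ^ 2 := by
  obtain ⟨Q, hQ', hQ, hMQ⟩ := exists_sorted_diagonalization hM
  set l := fun j : Fin d => sortedEigenvalue M (j.val + 1) with hl
  have hfro : ‖M‖ ^ 2 = ∑ j, l j ^ 2 := by
    have h1 : M = Q * diagonal l * Qᵀ := by rw [← hMQ, Matrix.mul_assoc, hQ, Matrix.mul_one]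
    have h2 : Mᵀ = M := by rw [← conjTranspose_eq_transpose_of_trivial]; exact hM
    rw [sq_norm_eq_trace, h2]
    calc (M * M).trace = (M * (Q * diagonal l * Qᵀ)).trace := by rw [← h1]
      _ = (Qᵀ * (M * Q * diagonal l)).trace := by
        rw [← Matrix.mul_assoc, trace_mul_comm, Matrix.mul_assoc M]
      _ = (diagonal l * diagonal l).trace := by
        rw [hMQ, Matrix.mul_assoc, ← Matrix.mul_assoc, hQ', Matrix.one_mul]
      _ = _ := by
        rw [diagonal_mul_diagonal, trace_diagonal]
        exact Finset.sum_congr rfl fun j _ => by ring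
  have hbound : ∀ j, |l j| ≤ 32 * t := by
    intro j
    -- At an eigenvalue of largest modulus the error of moving its eigenvector to the net is at most
    -- (31/32)|l j₀|, leaving |l j₀|/32 ≤ t.
    obtain ⟨j₀, -, hmax⟩ := Finset.exists_max_image Finset.univ (fun j => |l j|) ⟨j, Finset.mem_univ _⟩
    refine (hmax j (Finset.mem_univ _)).trans ?_
    have hx : Qᵀ *ᵥ (fun i => Q i j₀) = Pi.single j₀ 1 := by
      ext k
      have := congrFun (congrFun hQ' k) j₀
      rw [Matrix.mul_apply] at this
      simp only [mulVec, dotProduct]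
      rw [this, one_apply, Pi.single_apply]
    set x : Fin d → ℝ := fun i => Q i j₀ with hxdef
    have hx1 : x ⬝ᵥ x = 1 := by
      rw [dotProduct_self_eq_sum hQ, hx]
      simp [Pi.single_apply]
    have hxM : x ⬝ᵥ M *ᵥ x = l j₀ := by
      rw [quadratic_eq_sum hQ hMQ, hx]
      simp [Pi.single_apply, hl]
    obtain ⟨v, hv, hxv⟩ := hnet x hx1
    have hsum : (x + v) ⬝ᵥ (x + v) = 4 - (x - v) ⬝ᵥ (x - v) := by
      simp only [add_dotProduct, dotProduct_add, sub_dotProduct, dotProduct_sub, hx1, hT v hv]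
      ring
    -- In eigencoordinates, |a² - b²| = |a - b||a + b| ≤ 2(a - b)² + (a + b)²/8. With s = |x - v|² ≤
    -- 1/4 the sum is 2s + (4 - s)/8 ≤ 31/32.
    have hdiff : |x ⬝ᵥ M *ᵥ x - v ⬝ᵥ M *ᵥ v| ≤
        |l j₀| * (2 * ((x - v) ⬝ᵥ (x - v)) + 1 / 8 * ((x + v) ⬝ᵥ (x + v))) := by
      rw [quadratic_eq_sum hQ hMQ, quadratic_eq_sum hQ hMQ, dotProduct_self_eq_sum hQ (x - v),
        dotProduct_self_eq_sum hQ (x + v), ← Finset.sum_sub_distrib, Finset.mul_sum,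
        Finset.mul_sum, ← Finset.sum_add_distrib, Finset.mul_sum]
      refine (Finset.abs_sum_le_sum_abs _ _).trans (Finset.sum_le_sum fun k _ => ?_)
      rw [← mul_sub, abs_mul]
      refine mul_le_mul (hmax k (Finset.mem_univ _)) ?_ (abs_nonneg _) (abs_nonneg _)
      rw [mulVec_sub, mulVec_add, Pi.sub_apply, Pi.add_apply]
      set a := (Qᵀ *ᵥ x) k
      set b := (Qᵀ *ᵥ v) k
      rw [abs_le]
      constructor <;> nlinarith [sq_nonneg (4 * (a - b) - (a + b)), sq_nonneg (4 * (a - b) + (a + b))]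
    have h1 : 2 * ((x - v) ⬝ᵥ (x - v)) + 1 / 8 * ((x + v) ⬝ᵥ (x + v)) ≤ 31 / 32 := by
      rw [hsum]
      linarith
    have h2 := hdiff.trans (mul_le_mul_of_nonneg_left h1 (abs_nonneg _))
    rw [hxM] at h2
    have h3 := abs_sub_abs_le_abs_sub (l j₀) (v ⬝ᵥ M *ᵥ v)
    linarith [ht v hv]
  rw [hfro]
  calc ∑ j, l j ^ 2 ≤ ∑ _j : Fin d, (32 * t) ^ 2 := Finset.sum_le_sum fun j _ => by
        rw [← sq_abs]
        exact pow_le_pow_left₀ (abs_nonneg _) (hbound j) 2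
    _ = _ := by simp

/-! ### Bernstein's inequality for squares of sub-Gaussian variables -/

section SubGaussianSquare

open Real

lemma exp_le_one_add_add (s : ℝ) : exp s ≤ 1 + s + s ^ 2 * exp |s| := by
  have h := Complex.norm_exp_sub_sum_le_norm_mul_exp (s : ℂ) 2
  have h1 : Complex.exp (s : ℂ) - ∑ m ∈ Finset.range 2, (s : ℂ) ^ m / (m.factorial : ℂ)
      = ((exp s - (1 + s) : ℝ) : ℂ) := by
    simp [Finset.sum_range_succ]
  rw [h1, Complex.norm_real, Complex.norm_real, norm_eq_abs, norm_eq_abs, sq_abs] at h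
  linarith [le_abs_self (exp s - (1 + s))]

lemma sq_le_eight_mul_exp {w : ℝ} (hw : 0 ≤ w) : w ^ 2 ≤ 8 * exp (w / 2) := by
  have := quadratic_le_exp_of_nonneg (x := w / 2) (by positivity)
  nlinarith

variable {Ω : Type*} [MeasurableSpace Ω] {μ : Measure Ω} {X : Ω → ℝ} {c : ℝ≥0}

/-- The integrand cancels half of the Gaussian exponent -cg², so the variance doubles and the mass
becomes √2. -/
lemma lintegral_exp_sq_gaussian {c : ℝ} (hc : 0 < c) :
    ∫⁻ g, ENNReal.ofReal (exp (c * g ^ 2 / 2)) ∂(gaussianReal 0 (1 / (2 * c)).toNNReal)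
      = ENNReal.ofReal √2 := by
  have hv : (1 / (2 * c)).toNNReal ≠ 0 := by
    simpa using hc
  have hv' : ((1 / (2 * c)).toNNReal : ℝ) = 1 / (2 * c) := Real.coe_toNNReal _ (by positivity)
  rw [gaussianReal_of_var_ne_zero _ hv, lintegral_withDensity_eq_lintegral_mul _
    (measurable_gaussianPDF _ _) (by fun_prop)]
  have h1 : ∀ g : ℝ, (gaussianPDF 0 (1 / (2 * c)).toNNReal *
      fun g => ENNReal.ofReal (exp (c * g ^ 2 / 2))) g
      = ENNReal.ofReal (√(c / π) * exp (-(c / 2) * g ^ 2)) := by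
    intro g
    rw [Pi.mul_apply, gaussianPDF, ← ENNReal.ofReal_mul (gaussianPDFReal_nonneg _ _ _),
      gaussianPDFReal, hv', mul_assoc, ← exp_add, ← sqrt_inv]
    congr 3
    · field_simp
    · field_simp
      ring
  simp_rw [h1]
  rw [← ofReal_integral_eq_lintegral_ofReal
    ((integrable_exp_neg_mul_sq (by positivity)).const_mul _)
    (Filter.Eventually.of_forall fun g => by positivity), integral_const_mul, integral_gaussian,
    ← sqrt_mul (by positivity)]
  congr 2
  field_simp

/-- The exponential moment of the square of a sub-Gaussian variable. -/
lemma lintegral_exp_sq_le [IsProbabilityMeasure μ] (hX : HasSubgaussianMGF X c μ)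
    (hm : Measurable X) (hc : 0 < c) :
    ∫⁻ ω, ENNReal.ofReal (exp (1 / (4 * c) * X ω ^ 2)) ∂μ ≤ ENNReal.ofReal √2 := by
  have hc' : (0 : ℝ) < c := hc
  set γ := gaussianReal 0 (1 / (2 * (c : ℝ))).toNNReal with hγ
  have hv' : ((1 / (2 * (c : ℝ))).toNNReal : ℝ) = 1 / (2 * c) :=
    Real.coe_toNNReal _ (by positivity)
  -- Linearization of the square: exp(z²/(4c)) is the moment generating function at z of a centred
  -- Gaussian of variance 1/(2c). After Tonelli the sub-Gaussian bound applies for each fixed g.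
  have h1 : ∀ z : ℝ, ENNReal.ofReal (exp (1 / (4 * c) * z ^ 2)) =
      ∫⁻ g, ENNReal.ofReal (exp (g * z)) ∂γ := by
    intro z
    have hmgf := mgf_gaussianReal (p := γ) (X := id) (Measure.map_id) z
    rw [← ofReal_integral_eq_lintegral_ofReal]
    · rw [mgf] at hmgf
      simp only [id_eq, hv'] at hmgf
      simp_rw [mul_comm _ z]
      rw [hmgf]
      congr 2
      field_simp
      ring
    · simp_rw [mul_comm _ z]
      exact integrable_exp_mul_gaussianReal z
    · exact Filter.Eventually.of_forall fun g => (exp_pos _).le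
  simp_rw [h1]
  rw [lintegral_lintegral_swap (by fun_prop), ← lintegral_exp_sq_gaussian hc']
  refine lintegral_mono fun g => ?_
  rw [← ofReal_integral_eq_lintegral_ofReal (hX.integrable_exp_mul g)
    (Filter.Eventually.of_forall fun g => (exp_pos _).le)]
  exact ENNReal.ofReal_le_ofReal (hX.mgf_le g)

lemma integrable_exp_sq [IsProbabilityMeasure μ] (hX : HasSubgaussianMGF X c μ)
    (hm : Measurable X) (hc : 0 < c) :
    Integrable (fun ω => exp (1 / (4 * c) * X ω ^ 2)) μ := by
  refine ⟨by fun_prop, ?_⟩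
  rw [hasFiniteIntegral_iff_ofReal (Filter.Eventually.of_forall fun g => (exp_pos _).le)]
  exact (lintegral_exp_sq_le hX hm hc).trans_lt ENNReal.ofReal_lt_top

lemma integral_exp_sq_le [IsProbabilityMeasure μ] (hX : HasSubgaussianMGF X c μ)
    (hm : Measurable X) (hc : 0 < c) :
    ∫ ω, exp (1 / (4 * c) * X ω ^ 2) ∂μ ≤ √2 := by
  have h := lintegral_exp_sq_le hX hm hc
  rw [← ofReal_integral_eq_lintegral_ofReal (integrable_exp_sq hX hm hc)
    (Filter.Eventually.of_forall fun g => (exp_pos _).le)] at h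
  exact (ENNReal.ofReal_le_ofReal_iff (by positivity)).mp h

lemma integrable_sq [IsProbabilityMeasure μ] (hX : HasSubgaussianMGF X c μ) :
    Integrable (fun ω => X ω ^ 2) μ := (hX.memLp 2).integrable_sq

lemma integral_sq_le [IsProbabilityMeasure μ] (hX : HasSubgaussianMGF X c μ)
    (hm : Measurable X) (hc : 0 < c) : 1 / (4 * c) * ∫ ω, X ω ^ 2 ∂μ ≤ 1 / 2 := by
  have h1 : ∫ ω, (1 / (4 * c) * X ω ^ 2 + 1) ∂μ ≤ ∫ ω, exp (1 / (4 * c) * X ω ^ 2) ∂μ :=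
    integral_mono (((integrable_sq hX).const_mul _).add (integrable_const _))
      (integrable_exp_sq hX hm hc) fun ω => add_one_le_exp _
  rw [integral_add ((integrable_sq hX).const_mul _) (integrable_const _), integral_const_mul,
    integral_const, probReal_univ, one_smul] at h1
  have h2 := h1.trans (integral_exp_sq_le hX hm hc)
  have h3 : √2 ≤ 3 / 2 := sqrt_le_iff.mpr ⟨by norm_num, by norm_num⟩
  linarith

/-- Sub-exponential moment generating function of a centred squared sub-Gaussian variable. -/
lemma mgf_sq_sub_le [IsProbabilityMeasure μ] (hX : HasSubgaussianMGF X c μ)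
    (hm : Measurable X) (hc : 0 < c) {l : ℝ} (hl : |l| ≤ 1 / 2) :
    Integrable (fun ω => exp (l / (4 * c) * (X ω ^ 2 - ∫ ω, X ω ^ 2 ∂μ))) μ ∧
      mgf (fun ω => X ω ^ 2 - ∫ ω, X ω ^ 2 ∂μ) μ (l / (4 * c)) ≤ exp (20 * l ^ 2) := by
  have hc' : (0 : ℝ) < c := hc
  set m := ∫ ω, X ω ^ 2 ∂μ with hmdef
  set a : ℝ := 1 / (4 * c) with ha
  have ha0 : 0 < a := by positivity
  have hm0 : 0 ≤ m := integral_nonneg fun ω => sq_nonneg _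
  have ham : a * m ≤ 1 / 2 := integral_sq_le hX hm hc
  have hla : l / (4 * c) = l * a := by rw [ha]; ring
  rw [hla]
  have hexpint := integrable_exp_sq hX hm hc
  -- In the Taylor remainder, |l| ≤ 1/2 leaves exp(a|W|/2) and the square (a|W|)² costs another such
  -- factor. Their product is at most exp(1/2)·exp(aX²), which is integrable, while the linear term
  -- has mean zero.
  have hpt : ∀ ω, exp (l * a * (X ω ^ 2 - m)) ≤ 1 + l * a * (X ω ^ 2 - m)
      + 8 * l ^ 2 * exp (1 / 2) * exp (a * X ω ^ 2) := by
    intro ω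
    set W := X ω ^ 2 - m with hW
    have h1 := exp_le_one_add_add (l * a * W)
    have h2 : |l * a * W| ≤ a * |W| / 2 := by
      rw [abs_mul, abs_mul, abs_of_pos ha0]
      nlinarith [mul_nonneg ha0.le (abs_nonneg W)]
    have h3 : (a * |W|) ^ 2 ≤ 8 * exp (a * |W| / 2) := sq_le_eight_mul_exp (by positivity)
    have h4 : a * |W| ≤ 1 / 2 + a * X ω ^ 2 := by
      have : |W| ≤ X ω ^ 2 + m := by
        rw [hW, abs_le]
        constructor <;> linarith [sq_nonneg (X ω)]
      calc a * |W| ≤ a * (X ω ^ 2 + m) := by gcongr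
        _ ≤ _ := by linarith
    calc exp (l * a * W) ≤ 1 + l * a * W + (l * a * W) ^ 2 * exp |l * a * W| := h1
      _ ≤ 1 + l * a * W + l ^ 2 * (8 * exp (a * |W| / 2)) * exp (a * |W| / 2) := by
        have h5 : (l * a * W) ^ 2 ≤ l ^ 2 * (8 * exp (a * |W| / 2)) := by
          calc (l * a * W) ^ 2 = l ^ 2 * (a * |W|) ^ 2 := by rw [mul_pow a, sq_abs]; ring
            _ ≤ _ := by gcongr
        gcongr
      _ = 1 + l * a * W + 8 * l ^ 2 * exp (a * |W|) := by
        rw [show a * |W| = a * |W| / 2 + a * |W| / 2 by ring, exp_add]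
        ring_nf
      _ ≤ 1 + l * a * W + 8 * l ^ 2 * exp (1 / 2 + a * X ω ^ 2) := by gcongr
      _ = _ := by rw [exp_add]; ring
  have hint₁ : Integrable (fun ω => 1 + l * a * (X ω ^ 2 - m)) μ :=
    (integrable_const _).add (((integrable_sq hX).sub (integrable_const _)).const_mul _)
  have hint₂ : Integrable (fun ω => 8 * l ^ 2 * exp (1 / 2) * exp (a * X ω ^ 2)) μ :=
    hexpint.const_mul _
  have hint : Integrable (fun ω => exp (l * a * (X ω ^ 2 - m))) μ := by
    refine (hint₁.add hint₂).mono' (by fun_prop) (Filter.Eventually.of_forall fun ω => ?_)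
    rw [norm_eq_abs, abs_of_pos (exp_pos _)]
    exact hpt ω
  refine ⟨hint, ?_⟩
  have h1 : mgf (fun ω => X ω ^ 2 - m) μ (l * a) ≤ 1 + 8 * l ^ 2 * exp (1 / 2) * √2 := by
    refine (integral_mono hint (hint₁.add hint₂) hpt).trans ?_
    have hint₃ : Integrable (fun ω => X ω ^ 2 - m) μ :=
      (integrable_sq hX).sub (integrable_const _)
    rw [integral_add' hint₁ hint₂, integral_add (integrable_const _) (hint₃.const_mul _),
      integral_const_mul, integral_sub (integrable_sq hX) (integrable_const _),
      integral_const_mul]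
    simp only [integral_const, probReal_univ, one_smul, ← hmdef, sub_self, mul_zero, add_zero]
    gcongr
    exact integral_exp_sq_le hX hm hc
  have h2 : exp (1 / 2) * √2 ≤ 5 / 2 := by
    have h3 : exp (1 / 2) ^ 2 ≤ 2.7182818286 := by
      rw [← exp_nat_mul]
      rw [show ((2 : ℕ) : ℝ) * (1 / 2) = 1 by norm_num]
      exact exp_one_lt_d9.le
    have h4 : (exp (1 / 2) * √2) ^ 2 ≤ (5 / 2) ^ 2 := by
      rw [mul_pow, sq_sqrt (by norm_num)]
      linarith
    exact abs_le_of_sq_le_sq' h4 (by norm_num) |>.2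
  calc _ ≤ 1 + 8 * l ^ 2 * exp (1 / 2) * √2 := h1
    _ ≤ 20 * l ^ 2 + 1 := by nlinarith [sq_nonneg l]
    _ ≤ _ := add_one_le_exp _

/-- The Chernoff parameter in the two regimes: l = √x/2 gives 7x - 5x = 2x for x ≤ 1, and l = 1/2
gives 7x - 5 ≥ 2x for x ≥ 1. The 14 is the constant 56 divided by the 4 of the scaling 1/(4c). -/
lemma bernstein_exponent {x : ℝ} (hx : 0 ≤ x) :
    ∃ l : ℝ, 0 ≤ l ∧ l ≤ 1 / 2 ∧ 2 * x ≤ l * (14 * max (√x) x) - 20 * l ^ 2 := by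
  rcases le_total x 1 with h | h
  · have hs : x ≤ √x := by
      rw [le_sqrt hx hx]
      nlinarith
    refine ⟨√x / 2, by positivity, by linarith [sqrt_le_one.mpr h], ?_⟩
    rw [max_eq_left hs]
    nlinarith [sq_sqrt hx]
  · refine ⟨1 / 2, by norm_num, le_rfl, ?_⟩
    nlinarith [le_max_right (√x) x]

/-- Two-sided Bernstein inequality for an average of squared sub-Gaussian variables. -/
lemma measureReal_average_sq_sub_le {n : ℕ} (hn : 0 < n) {X : Fin n → Ω → ℝ}
    (hind : iIndepFun X μ) (hm : ∀ j, Measurable (X j)) (hX : ∀ j, HasSubgaussianMGF (X j) c μ)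
    {m : ℝ} (hmean : ∀ j, ∫ ω, X j ω ^ 2 ∂μ = m) {x : ℝ} (hx : 0 ≤ x) :
    μ.real {ω | 56 * c * max (√x) x < |1 / (n : ℝ) * ∑ j, X j ω ^ 2 - m|}
      ≤ 2 * exp (-(2 * (n * x))) := by
  have : IsProbabilityMeasure μ := hind.isProbabilityMeasure
  have hn' : (0 : ℝ) < n := by exact_mod_cast hn
  -- The scaling 1/(4c) is meaningless for c = 0, where the variables vanish almost surely.
  rcases eq_or_lt_of_le (show 0 ≤ c from zero_le) with hc | hc
  · subst hc
    have h0 : ∀ᵐ ω ∂μ, ∀ j, X j ω = 0 :=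
      ae_all_iff.mpr fun j => (hX j).ae_eq_zero_of_hasSubgaussianMGF_zero
    have hm0 : m = 0 := by
      rw [← hmean ⟨0, hn⟩]
      refine integral_eq_zero_of_ae ?_
      filter_upwards [h0] with ω hω
      simp [hω]
    have hnull : μ {ω | 56 * ((0 : ℝ≥0) : ℝ) * max (√x) x <
        |1 / (n : ℝ) * ∑ j, X j ω ^ 2 - m|} = 0 := by
      refine measure_mono_null ?_ (ae_iff.mp h0)
      intro ω hω hall
      simp [hall, hm0] at hω
    rw [measureReal_def, hnull]
    simp only [ENNReal.toReal_zero]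
    positivity
  have hc' : (0 : ℝ) < c := hc
  obtain ⟨l, hl0, hl1, hexp⟩ := bernstein_exponent hx
  set t := 56 * (c : ℝ) * max (√x) x with ht
  let Y : Fin n → Ω → ℝ := fun j ω => X j ω ^ 2 - m
  have hYm : ∀ j, Measurable (Y j) := fun j => ((hm j).pow_const 2).sub_const m
  have hYind : iIndepFun Y μ :=
    hind.comp (fun _ z => z ^ 2 - m) fun _ => by fun_prop
  have hmgf : ∀ s : ℝ, |s| ≤ 1 / 2 →
      Integrable (fun ω => exp (s / (4 * c) * (∑ j, Y j) ω)) μ ∧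
        mgf (∑ j, Y j) μ (s / (4 * c)) ≤ exp (20 * s ^ 2 * n) := by
    intro s hs
    have hj : ∀ j, Integrable (fun ω => exp (s / (4 * c) * Y j ω)) μ ∧
        mgf (Y j) μ (s / (4 * c)) ≤ exp (20 * s ^ 2) := by
      intro j
      have := mgf_sq_sub_le (hX j) (hm j) hc hs
      rwa [hmean j] at this
    refine ⟨hYind.integrable_exp_mul_sum hYm fun j _ => (hj j).1, ?_⟩
    rw [hYind.mgf_sum hYm]
    refine (Finset.prod_le_prod (fun _ _ => mgf_nonneg) fun j _ => (hj j).2).trans_eq ?_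
    rw [Finset.prod_const, Finset.card_univ, Fintype.card_fin, ← exp_nat_mul]
    ring_nf
  have hbound : exp (-(l / (4 * c)) * (n * t)) * exp (20 * l ^ 2 * n)
      ≤ exp (-(2 * (n * x))) := by
    rw [← exp_add, exp_le_exp]
    have h1 : -(l / (4 * c)) * (n * t) = -(n * (l * (14 * max (√x) x))) := by
      rw [ht]
      field_simp
      ring
    rw [h1]
    nlinarith
  have hup : μ.real {ω | (n : ℝ) * t ≤ (∑ j, Y j) ω} ≤ exp (-(2 * (n * x))) := by
    obtain ⟨hi, hle⟩ := hmgf l (by rwa [abs_of_nonneg hl0])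
    refine (measure_ge_le_exp_mul_mgf _ (by positivity) hi).trans (le_trans ?_ hbound)
    gcongr
  have hdown : μ.real {ω | (∑ j, Y j) ω ≤ -((n : ℝ) * t)} ≤ exp (-(2 * (n * x))) := by
    obtain ⟨hi, hle⟩ := hmgf (-l) (by rwa [abs_neg, abs_of_nonneg hl0])
    have hneg : -l / (4 * (c : ℝ)) ≤ 0 := by
      rw [neg_div]
      exact neg_nonpos.mpr (by positivity)
    refine (measure_le_le_exp_mul_mgf _ hneg hi).trans (le_trans ?_ hbound)
    rw [neg_sq] at hle
    rw [show -(-l / (4 * (c : ℝ))) * -(n * t) = -(l / (4 * c)) * (n * t) by ring]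
    gcongr
  have hsub : {ω | t < |1 / (n : ℝ) * ∑ j, X j ω ^ 2 - m|} ⊆
      {ω | (n : ℝ) * t ≤ (∑ j, Y j) ω} ∪ {ω | (∑ j, Y j) ω ≤ -((n : ℝ) * t)} := by
    intro ω hω
    have h1 : (∑ j, Y j) ω = n * (1 / (n : ℝ) * ∑ j, X j ω ^ 2 - m) := by
      simp only [Finset.sum_apply, Y, Finset.sum_sub_distrib, Finset.sum_const, Finset.card_univ,
        Fintype.card_fin, nsmul_eq_mul]
      field_simp
    simp only [Set.mem_union, Set.mem_ofPred_eq, h1]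
    rcases lt_abs.mp (show t < |1 / (n : ℝ) * ∑ j, X j ω ^ 2 - m| from hω) with h | h
    · left
      gcongr
    · right
      rw [← mul_neg]
      exact mul_le_mul_of_nonneg_left (by linarith) hn'.le
  calc _ ≤ _ := measureReal_mono hsub
    _ ≤ _ := measureReal_union_le _ _
    _ ≤ _ := by linarith

/-- From 1 + t·E[X] ≤ exp(ct²/2) follows t·E[X] ≤ ct² for small t > 0, so E[X] ≤ 0; the same holds
for -X. This reconciles the centred population covariance with the uncentred sample covariance. -/
lemma integral_eq_zero_of_hasSubgaussianMGF [IsProbabilityMeasure μ]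
    (hX : HasSubgaussianMGF X c μ) : ∫ ω, X ω ∂μ = 0 := by
  have key : ∀ {X : Ω → ℝ}, HasSubgaussianMGF X c μ → ∫ ω, X ω ∂μ ≤ 0 := by
    intro X hX
    refine le_of_forall_pos_le_add fun ε hε => ?_
    obtain ⟨t, ht0, ht1, ht2⟩ : ∃ t : ℝ, 0 < t ∧ c * t ^ 2 / 2 ≤ 1 ∧ c * t ≤ ε := by
      refine ⟨min 1 (min 1 ε / (c + 1)), by positivity, ?_, ?_⟩
      all_goals
        set t := min 1 (min 1 ε / ((c : ℝ) + 1)) with ht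
        have h1 : t ≤ 1 := min_le_left _ _
        have h2 : t ≤ min 1 ε / (c + 1) := min_le_right _ _
        have h0 : 0 ≤ t := by positivity
        rw [le_div_iff₀ (by positivity)] at h2
        have h3 := min_le_left 1 ε
        have h4 := min_le_right 1 ε
        have h5 : 0 ≤ (c : ℝ) := c.coe_nonneg
        nlinarith
    have h1 : ∫ ω, (t * X ω + 1) ∂μ ≤ mgf X μ t :=
      integral_mono ((hX.integrable.const_mul _).add (integrable_const _))
        (hX.integrable_exp_mul t) fun ω => add_one_le_exp _
    rw [integral_add (hX.integrable.const_mul _) (integrable_const _), integral_const_mul,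
      integral_const, probReal_univ, one_smul] at h1
    have hu : 0 ≤ c * t ^ 2 / 2 := by positivity
    have h2 := abs_le.mp (abs_exp_sub_one_sub_id_le (x := c * t ^ 2 / 2) (by rwa [abs_of_nonneg hu]))
    have h3 := hX.mgf_le t
    have h4 : t * ∫ ω, X ω ∂μ ≤ t * (c * t) := by nlinarith [h2.2]
    have := le_of_mul_le_mul_left h4 ht0
    linarith
  refine le_antisymm (key hX) ?_
  have := key hX.neg
  simp only [Pi.neg_apply, integral_neg] at this
  linarith

end SubGaussianSquare

/-! ### Quadratic forms of covariance matrices and the union bound -/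

/-- The quadratic form of the covariance matrix is the second moment of the projection. -/
lemma quadratic_populationCovariance {d : ℕ} {ν : Measure (Fin d → ℝ)} [IsProbabilityMeasure ν]
    {σ : ℝ≥0} (hsub : IsSubGaussian ν σ) {v : Fin d → ℝ} (hv : v ⬝ᵥ v = 1) :
    v ⬝ᵥ populationCovariance ν *ᵥ v = ∫ x, (v ⬝ᵥ x) ^ 2 ∂ν := by
  have hmem : ∀ k, MemLp (fun x : Fin d → ℝ => v k * x k) 2 ν := by
    intro k
    have := (hsub (Pi.single k 1) (by simp)).memLp 2
    simp only [single_one_dotProduct] at this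
    exact this.const_mul _
  have hvar := variance_of_integral_eq_zero (hsub v hv).aemeasurable
    (integral_eq_zero_of_hasSubgaussianMGF (hsub v hv))
  rw [← covariance_self (hsub v hv).aemeasurable] at hvar
  simp only [dotProduct] at hvar ⊢
  rw [← hvar, covariance_fun_sum_fun_sum hmem hmem]
  refine Finset.sum_congr rfl fun k _ => ?_
  rw [mulVec, dotProduct, Finset.mul_sum]
  refine Finset.sum_congr rfl fun l _ => ?_
  rw [covariance_const_mul_left, covariance_const_mul_right, populationCovariance, of_apply]
  ring

lemma quadratic_sampleCovariance {d n : ℕ} (y : Fin n → (Fin d → ℝ)) (v : Fin d → ℝ) :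
    v ⬝ᵥ sampleCovariance (dataMatrix y) *ᵥ v = 1 / (n : ℝ) * ∑ j, (v ⬝ᵥ y j) ^ 2 := by
  rw [sampleCovariance, smul_mulVec, dotProduct_smul, smul_eq_mul, ← mulVec_mulVec,
    dotProduct_mulVec, ← mulVec_transpose]
  congr 1
  refine Finset.sum_congr rfl fun j _ => ?_
  have : ((dataMatrix y)ᵀ *ᵥ v) j = v ⬝ᵥ y j := by
    simp [mulVec, dotProduct, dataMatrix, mul_comm]
  rw [this, sq]

lemma transpose_sampleCovariance {d n : ℕ} (Y : Matrix (Fin d) (Fin n) ℝ) :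
    (sampleCovariance Y)ᵀ = sampleCovariance Y := by
  rw [sampleCovariance, transpose_smul, transpose_mul, transpose_transpose]

/-- With q = η/(2N) the exponential is exp(-2)^d·q². The factor 2 in the exponent matters: 5 ≤ e²
absorbs the size of the net, and 2q² ≤ 2q = η/N. -/
lemma net_failure_probability_le (d : ℕ) {N : ℕ} (hN : 0 < N) {η : ℝ} (hη₀ : 0 < η)
    (hη₁ : η < 1) :
    (5 : ℝ) ^ d * (2 * Real.exp (-(2 * (d + Real.log (2 * N / η))))) ≤ η / N := by
  have hN' : (1 : ℝ) ≤ N := by exact_mod_cast hN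
  set q := η / (2 * (N : ℝ)) with hq
  have hq0 : 0 < q := by positivity
  have hq1 : q ≤ 1 := by
    rw [hq, div_le_one (by positivity)]
    linarith
  have h1 : Real.exp (-(2 * (d + Real.log (2 * N / η)))) = Real.exp (-2) ^ d * q ^ 2 := by
    have h2 : Real.log (2 * N / η) = -Real.log q := by
      rw [hq, ← Real.log_inv, inv_div]
    rw [h2, ← Real.exp_nat_mul, ← Real.exp_log hq0, ← Real.exp_nat_mul, ← Real.exp_add,
      Real.log_exp]
    congr 1
    push_cast
    ring
  have h3 : 5 * Real.exp (-2) ≤ 1 := by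
    have h4 : (5 : ℝ) ≤ Real.exp 2 := by
      have h5 := Real.exp_one_gt_d9
      rw [show (2 : ℝ) = 1 + 1 by norm_num, Real.exp_add]
      nlinarith
    rw [Real.exp_neg, ← div_eq_mul_inv]
    exact (div_le_one (Real.exp_pos _)).mpr h4
  calc (5 : ℝ) ^ d * (2 * Real.exp (-(2 * (d + Real.log (2 * N / η)))))
      = 2 * q ^ 2 * (5 * Real.exp (-2)) ^ d := by rw [h1, mul_pow]; ring
    _ ≤ 2 * q ^ 2 * 1 := by
        gcongr
        exact pow_le_one₀ (by positivity) h3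
    _ ≤ 2 * q := by nlinarith
    _ = η / N := by rw [hq]; field_simp

/-! ### Concentration of the sample covariance matrices -/

section Concentration

variable {Ω : Type*} [MeasurableSpace Ω] {μ : Measure Ω} [IsProbabilityMeasure μ]

/-- The quadratic form of one sample covariance matrix concentrates in a fixed direction. -/
lemma measureReal_quadratic_deviation_le {d n : ℕ} (hn : 0 < n) {ν : Measure (Fin d → ℝ)}
    {y : Fin n → Ω → (Fin d → ℝ)} {σ : ℝ≥0} (hiid : IsIIDSample μ y ν)
    (hsub : IsSubGaussian ν σ) {v : Fin d → ℝ} (hv : v ⬝ᵥ v = 1) {L : ℝ} (hL : 0 ≤ L) :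
    μ.real {ω | 56 * (σ : ℝ) ^ 2 * max (√(L / n)) (L / n) <
        |1 / (n : ℝ) * ∑ j, (v ⬝ᵥ y j ω) ^ 2 - v ⬝ᵥ populationCovariance ν *ᵥ v|}
      ≤ 2 * Real.exp (-(2 * L)) := by
  have hn' : (0 : ℝ) < n := by exact_mod_cast hn
  have hν : IsProbabilityMeasure ν := by
    rw [← hiid.map_eq ⟨0, hn⟩]
    exact Measure.isProbabilityMeasure_map (hiid.measurable _).aemeasurable
  have hmeas : Measurable fun x : Fin d → ℝ => v ⬝ᵥ x := by
    simp only [dotProduct]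
    fun_prop
  have hX : ∀ j, HasSubgaussianMGF (fun ω => v ⬝ᵥ y j ω) (σ ^ 2) μ := fun j =>
    HasSubgaussianMGF.of_map (X := fun x => v ⬝ᵥ x) (hiid.measurable j).aemeasurable
      (by rw [hiid.map_eq j]; exact hsub v hv)
  have hmean : ∀ j, ∫ ω, (v ⬝ᵥ y j ω) ^ 2 ∂μ = v ⬝ᵥ populationCovariance ν *ᵥ v := by
    intro j
    rw [quadratic_populationCovariance hsub hv, ← hiid.map_eq j,
      integral_map (hiid.measurable j).aemeasurable (by fun_prop)]
  -- The choice x = L/n makes the exponent nx equal to L, the same for all clients.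
  have h := measureReal_average_sq_sub_le hn (X := fun j ω => v ⬝ᵥ y j ω)
    (hiid.indep.comp (fun _ x => v ⬝ᵥ x) fun _ => hmeas)
    (fun j => hmeas.comp (hiid.measurable j)) hX hmean (x := L / n) (by positivity)
  rw [mul_div_cancel₀ L hn'.ne'] at h
  exact_mod_cast h

/-- Simultaneous concentration of the sample covariance matrices in Frobenius norm. -/
lemma exists_concentration_event {d N : ℕ} (hN : 0 < N) {n : Fin N → ℕ} (hn : ∀ i, 0 < n i)
    {ν : Fin N → Measure (Fin d → ℝ)} {y : ∀ i, Fin (n i) → Ω → (Fin d → ℝ)} {σ : ℝ≥0}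
    (hiid : ∀ i, IsIIDSample μ (y i) (ν i)) (hsub : ∀ i, IsSubGaussian (ν i) σ)
    (hcov : ∀ i, (populationCovariance (ν i)).IsHermitian)
    {η : ℝ} (hη₀ : 0 < η) (hη₁ : η < 1) {L : ℝ} (hL : L = d + Real.log (2 * N / η))
    (hL0 : 0 ≤ L) :
    ∃ E : Set Ω, MeasurableSet E ∧ 1 - η ≤ μ.real E ∧ ∀ ω ∈ E, ∀ i,
      ‖sampleCovariance (dataMatrix fun j => y i j ω) - populationCovariance (ν i)‖ ^ 2 ≤
        d * (1792 * (σ : ℝ) ^ 2) ^ 2 * max ((L / n i) ^ 2) (L / n i) := by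
  obtain ⟨T, hTcard, hT, hnet⟩ := exists_sphere_net d
  have hN' : (0 : ℝ) < N := by exact_mod_cast hN
  let t : Fin N → ℝ := fun i => 56 * (σ : ℝ) ^ 2 * max (√(L / n i)) (L / n i)
  let B : Fin N → (Fin d → ℝ) → Set Ω := fun i v => {ω | t i <
    |1 / (n i : ℝ) * ∑ j, (v ⬝ᵥ y i j ω) ^ 2 - v ⬝ᵥ populationCovariance (ν i) *ᵥ v|}
  have hB : ∀ i v, MeasurableSet (B i v) := by
    intro i v
    refine measurableSet_lt measurable_const ?_
    have : ∀ j, Measurable (y i j) := (hiid i).measurable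
    simp only [dotProduct]
    fun_prop
  have hBad : MeasurableSet (⋃ i, ⋃ v ∈ T, B i v) :=
    MeasurableSet.iUnion fun i => T.measurableSet_biUnion fun v _ => hB i v
  refine ⟨(⋃ i, ⋃ v ∈ T, B i v)ᶜ, hBad.compl, ?_, ?_⟩
  · have hi : ∀ i, μ.real (⋃ v ∈ T, B i v) ≤ η / N := by
      intro i
      refine (measureReal_biUnion_finset_le T (B i)).trans ?_
      refine (Finset.sum_le_card_nsmul T _ (2 * Real.exp (-(2 * L))) fun v hv =>
        measureReal_quadratic_deviation_le (hn i) (hiid i) (hsub i) (hT v hv) hL0).trans ?_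
      refine le_trans ?_ (net_failure_probability_le d hN hη₀ hη₁)
      rw [nsmul_eq_mul, ← hL]
      gcongr
      exact_mod_cast hTcard
    have htot : μ.real (⋃ i, ⋃ v ∈ T, B i v) ≤ η := by
      refine (measureReal_iUnion_fintype_le _).trans ?_
      refine (Finset.sum_le_sum fun i _ => hi i).trans_eq ?_
      rw [Finset.sum_const, Finset.card_univ, Fintype.card_fin, nsmul_eq_mul]
      field_simp
    rw [probReal_compl_eq_one_sub hBad]
    linarith
  · intro ω hω i
    have hx : 0 ≤ L / n i := by positivity
    have hquad : ∀ v ∈ T, |v ⬝ᵥ (sampleCovariance (dataMatrix fun j => y i j ω) -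
        populationCovariance (ν i)) *ᵥ v| ≤ t i := by
      intro v hv
      rw [sub_mulVec, dotProduct_sub, quadratic_sampleCovariance]
      by_contra! hlt
      exact hω (Set.mem_iUnion.mpr ⟨i, Set.mem_biUnion hv hlt⟩)
    -- Here 1792 = 32 · 56, the net constant times the Bernstein constant.
    refine (sq_norm_le_of_net hT hnet ((isHermitian_of_isSymm
      (transpose_sampleCovariance _)).sub (hcov i)) hquad).trans_eq ?_
    have hmax : max (√(L / n i)) (L / n i) ^ 2 = max ((L / n i) ^ 2) (L / n i) := by
      rw [max_comm, (pow_left_monotoneOn (n := 2)).map_max hx (Real.sqrt_nonneg _),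
        Real.sq_sqrt hx]
    rw [← hmax]
    simp only [t]
    ring

end Concentration

end PerPCA


/-! ### Assembly of the consistency bound -/

theorem corollary1 :
    ∃ C : ℝ, 0 < C ∧
      ∀ {Ω : Type*} [MeasurableSpace Ω] (μ : Measure Ω) [IsProbabilityMeasure μ]
        (d r₁ N : ℕ) (r₂ n : Fin N → ℕ)
        (_hN : 0 < N) (_hr₁ : 0 < r₁) (_hr₂ : ∀ i, 0 < r₂ i) (_hn : ∀ i, 0 < n i)
        -- the data: `y i j` is the `j`-th observation of client `i`, with law `ν i`
        (ν : Fin N → Measure (Fin d → ℝ)) (y : ∀ i, Fin (n i) → Ω → (Fin d → ℝ))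
        (σ : ℝ≥0)
        (_hiid : ∀ i, PerPCA.IsIIDSample μ (y i) (ν i))
        (_hsub : ∀ i, PerPCA.IsSubGaussian (ν i) σ)
        -- the true global and local principal components
        (U₀ : Matrix (Fin d) (Fin r₁) ℝ) (V₀ : ∀ i, Matrix (Fin d) (Fin (r₂ i)) ℝ)
        (_hU₀ : U₀ᵀ * U₀ = 1) (_hV₀ : ∀ i, (V₀ i)ᵀ * V₀ i = 1)
        -- orthogonal decomposition of the population covariance matrices
        (Sg Sl : Fin N → Matrix (Fin d) (Fin d) ℝ)
        (_hdecomp : ∀ i,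
          PerPCA.IsOrthogonalDirectSum (PerPCA.populationCovariance (ν i)) (Sg i) (Sl i))
        (_hcolg : ∀ i, PerPCA.ColSubset (PerPCA.proj U₀) (Sg i))
        (_hcoll : ∀ i, PerPCA.ColSubset (PerPCA.proj (V₀ i)) (Sl i))
        (_htopg : ∀ i, PerPCA.IsTopEigenspaceProjection (Sg i) r₁ (PerPCA.proj U₀))
        (_htopl : ∀ i, PerPCA.IsTopEigenspaceProjection (Sl i) (r₂ i) (PerPCA.proj (V₀ i)))
        -- identifiability
        (θ : ℝ) (_hθ₀ : 0 < θ) (_hθ₁ : θ < 1)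
        (_hident :
          PerPCA.maxEigenvalue ((1 / (N : ℝ)) • ∑ i, PerPCA.proj (V₀ i)) ≤ 1 - θ)
        -- eigengap
        (δ : ℝ) (_hδ : 0 < δ)
        (_hgap : ∀ i, δ ≤
          min (PerPCA.sortedEigenvalue (Sg i) r₁) (PerPCA.sortedEigenvalue (Sl i) (r₂ i))
            - max (PerPCA.sortedEigenvalue (Sg i) (r₁ + 1))
                (PerPCA.sortedEigenvalue (Sl i) (r₂ i + 1)))
        -- failure probability
        (η : ℝ) (_hη₀ : 0 < η) (_hη₁ : η < 1),
        ∃ E : Set Ω, MeasurableSet E ∧ 1 - η ≤ μ.real E ∧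
          ∀ ω ∈ E, ∀ (U : Matrix (Fin d) (Fin r₁) ℝ) (V : ∀ i, Matrix (Fin d) (Fin (r₂ i)) ℝ),
            PerPCA.IsOptimal
              (fun i => PerPCA.sampleCovariance (PerPCA.dataMatrix fun j => y i j ω)) U V →
            -- the error bound
            PerPCA.subspaceError U U₀ V V₀ ≤
              4 / (θ * δ ^ 2) * (σ : ℝ) ^ 4 * C ^ 2 * ((d : ℝ) / N) *
                ∑ i, max (((d + Real.log (2 * N / η)) / (n i : ℝ)) ^ 2)
                  ((d + Real.log (2 * N / η)) / (n i : ℝ)) ∧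
            -- the resulting rate, in terms of the average of `1 / n i`
            ((∀ i, d + Real.log (2 * N / η) ≤ (n i : ℝ)) →
              PerPCA.subspaceError U U₀ V V₀ ≤
                4 / (θ * δ ^ 2) * (σ : ℝ) ^ 4 * C ^ 2 * d * (d + Real.log (2 * N / η)) *
                  ((1 / (N : ℝ)) * ∑ i, 1 / (n i : ℝ))) ∧
            -- the `O(1 / m)` rate when all clients have at least `m` observations
            (∀ m : ℕ, (∀ i, m ≤ n i) → d + Real.log (2 * N / η) ≤ (m : ℝ) →
              PerPCA.subspaceError U U₀ V V₀ ≤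
                4 / (θ * δ ^ 2) * (σ : ℝ) ^ 4 * C ^ 2 * d * (d + Real.log (2 * N / η)) *
                  (1 / (m : ℝ))) := by
  -- The two parts combine to the constant 20 · 1792² = 64225280, which is at most 4 · 5000² = 10⁸.
  refine ⟨5000, by norm_num, ?_⟩
  intro Ω _ μ _ d r₁ N r₂ n hN hr₁ hr₂ hn ν y σ hiid hsub U₀ V₀ hU₀ hV₀ Sg Sl hdecomp hcolg hcoll
    htopg htopl θ hθ₀ hθ₁ hident δ hδ hgap η hη₀ hη₁
  have hN' : (1 : ℝ) ≤ N := by exact_mod_cast hN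
  set L : ℝ := d + Real.log (2 * N / η) with hL
  have hL0 : 0 < L := by
    have : 0 < Real.log (2 * N / η) := Real.log_pos ((one_lt_div hη₀).mpr (by linarith))
    positivity
  have hcov : ∀ i, (PerPCA.populationCovariance (ν i)).IsHermitian := fun i => by
    rw [(hdecomp i).eq_add]
    exact (PerPCA.isHermitian_of_isSymm (hdecomp i).symm_left).add
      (PerPCA.isHermitian_of_isSymm (hdecomp i).symm_right)
  obtain ⟨E, hE, hEprob, hconc⟩ :=
    PerPCA.exists_concentration_event hN hn hiid hsub hcov hη₀ hη₁ hL hL0.le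
  refine ⟨E, hE, hEprob, fun ω hω U V hopt => ?_⟩
  have hdet := PerPCA.subspaceError_le hN hr₂ hU₀ hV₀
    (fun i => PerPCA.transpose_sampleCovariance _) hdecomp hcolg hcoll htopg htopl hθ₀ hθ₁ hident
    hδ hgap hopt
  have hn' : ∀ i, (0 : ℝ) < n i := fun i => by exact_mod_cast hn i
  set K : ℝ := 4 / (θ * δ ^ 2) * (σ : ℝ) ^ 4 * 5000 ^ 2 with hK
  have hK0 : 0 ≤ K := by positivity
  have hmain : PerPCA.subspaceError U U₀ V V₀ ≤
      K * ((d : ℝ) / N) * ∑ i, max ((L / (n i : ℝ)) ^ 2) (L / (n i : ℝ)) := by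
    set M := ∑ i, max ((L / (n i : ℝ)) ^ 2) (L / (n i : ℝ)) with hM
    have hM0 : 0 ≤ M := Finset.sum_nonneg fun i _ => le_max_of_le_left (sq_nonneg _)
    calc _ ≤ _ := hdet
      _ ≤ 20 / (θ * δ ^ 2) * (1 / (N : ℝ) * (d * (1792 * (σ : ℝ) ^ 2) ^ 2 * M)) := by
        have := Finset.sum_le_sum fun i (_ : i ∈ Finset.univ) => hconc ω hω i
        rw [← Finset.mul_sum] at this
        gcongr
      _ = 64225280 * ((σ : ℝ) ^ 4 / (θ * δ ^ 2) * (d / N) * M) := by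
        field_simp
        ring
      _ ≤ 100000000 * ((σ : ℝ) ^ 4 / (θ * δ ^ 2) * (d / N) * M) := by
        gcongr
        norm_num
      _ = _ := by
        rw [hK]
        field_simp
        ring
  have hrate : (∀ i, L ≤ (n i : ℝ)) → PerPCA.subspaceError U U₀ V V₀ ≤
      K * d * L * ((1 / (N : ℝ)) * ∑ i, 1 / (n i : ℝ)) := by
    intro hLn
    refine hmain.trans_eq ?_
    -- When L ≤ nᵢ the ratio is at most 1, so the linear term dominates its square.
    have hmax : ∀ i, max ((L / (n i : ℝ)) ^ 2) (L / (n i : ℝ)) = L * (1 / (n i : ℝ)) := by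
      intro i
      have h0 : 0 ≤ L / n i := (div_pos hL0 (hn' i)).le
      have h1 : L / n i ≤ 1 := (div_le_one (hn' i)).mpr (hLn i)
      rw [max_eq_right (by nlinarith), mul_one_div]
    simp_rw [hmax]
    rw [← Finset.mul_sum]
    ring
  refine ⟨hmain, hrate, fun m hm hLm => ?_⟩
  have hm0 : (0 : ℝ) < m := hL0.trans_le hLm
  refine (hrate fun i => hLm.trans (by exact_mod_cast hm i)).trans ?_
  refine mul_le_mul_of_nonneg_left ?_ (by positivity)
  have hsum : ∑ i, 1 / (n i : ℝ) ≤ N * (1 / (m : ℝ)) := by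
    refine (Finset.sum_le_card_nsmul Finset.univ _ (1 / (m : ℝ)) fun i _ =>
      one_div_le_one_div_of_le hm0 (by exact_mod_cast hm i)).trans_eq ?_
    rw [Finset.card_univ, Fintype.card_fin, nsmul_eq_mul]
  calc (1 / (N : ℝ)) * ∑ i, 1 / (n i : ℝ) ≤ (1 / (N : ℝ)) * (N * (1 / (m : ℝ))) := by gcongr
    _ = _ := by field_simp
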